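/- Consider the linear system $$\dot x=Ax+B_1w+B_2u,\qquad z=C_1x+D_1u,\qquad y=C_2x+D_2v,$$ with state $x\in\mathbb R^n$, input $u\in\mathbb R^m$, controlled output $z\in\mathbb R^{n_z}$, measurement $y\in\mathbb R^l$ and disturbances $w\in\mathbb R^{n_w}$, $v\in\mathbb R^{n_v}$, and let $K\in\mathbb R^{m\times l}$. Let $\gamma>0$, $h>0$, $\eta_M\ge0$, $\varepsilon\ge0$, $\delta>0$, and let $\Omega\ge 0$ be an $l\times l$ matrix. The sampling instants are generated by the switching event-trigger: $s_0=0$ and $$s_{k+1}=\min\{s\ge s_k+h\;:\;(y(s)-y(s_k))^T\Omega(y(s)-y(s_k))\ge\varepsilon\,y(s)^T\Omega y(s)\},\qquad k\ge0.$$ The measurement $y(s_k)$ is subject to a delay $\eta_k\in[0,\eta_M]$; the updating times $t_k=s_k+\eta_k$ satisfy $t_k\le t_{k+1}$. The input is $u(t)=Ky(s_k)$ for $t\in[t_k,t_{k+1})$, and $u(t)=0$ for $0\le t<t_0$. Trajectories are infinite event sequences $(s_k)$, delays $(\eta_k)$ and (absolutely continuous) solutions $x$ on $[0,\infty)$ of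 this closed loop. For $t\in[t_k,t_{k+1})$ define $\tau(t)=t-s_k$ if $t<t_k+h$ or $s_{k+1}=s_k+h$, and otherwise $$\tau(t)=\frac{t_{k+1}-t}{t_{k+1}-t_k-h}\,\eta_k+\frac{t-t_k-h}{t_{k+1}-t_k-h}\,\eta_{k+1};$$ for $t<t_0$ read $v(t-\tau(t))$ as $0$. The closed loop is called *internally exponentially stable with decay rate $\delta$* if there is $M>0$ such that, for $w\equiv0$, $v\equiv0$, all trajectories (for all admissible delays) satisfy $|x(t)|\le Me^{-\delta t}|x(0)|$, $t\ge0$. It has *$L_2$-gain less than $\gamma$* if for $x(0)=0$, all $w,v\in L_2[0,\infty)$ and all trajectories for which $w^T(t)w(t)+v^T(t-\tau(t))v(t-\tau(t))$ does not vanish for almost all $t\ge0$, $$J=\int_0^\infty\bigl\{z^Tz-\gamma^2[w^Tw+v^T(t-\tau(t))v(t-\tau(t))]\bigr\}\,dt<0 .$$ Here $J<0$ means that $\limsup_{T\to\infty}\int_0^T\{\cdots\}\,dt<0$, the integrand being integrable on every $[0,T]$, and moreover that the integrand is integrable on $[0,\infty)$ with negative integral whenever $v(t-\tau(t))$ is square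 integrable. **Theorem.** Put $\tau_M=h+\eta_M$, $a=e^{-2\delta\eta_M}$, $b=e^{-2\delta\tau_M}$. Suppose there are $n\times n$ matrices $P>0$, $S_0,S_1,R_0,R_1\ge0$ and $G_0,G_1$ which, together with the matrix $\Omega\ge0$ of the event-trigger, satisfy (the symbols $>0$, $\ge0$ include symmetry) $$\Psi\le0,\qquad\Phi\le0,\qquad\begin{bmatrix}R_0&G_0\\G_0^T&R_0\end{bmatrix}\ge0,\qquad\begin{bmatrix}R_1&G_1\\G_1^T&R_1\end{bmatrix}\ge0,$$ where, with $H=\eta_M^2R_0+h^2R_1$, $\Psi=\{\Psi_{ij}\}_{i,j\le7}$ and $\Phi=\{\Phi_{ij}\}_{i,j\le8}$ are the symmetric block matrices with blocks $$\begin{array}{l} \Psi_{11}=\Phi_{11}=A^TP+PA+2\delta P+S_0-aR_0+C_1^TC_1,\quad \Psi_{12}=aR_0,\quad \Psi_{14}=PB_2KC_2+C_1^TD_1KC_2,\\ \Psi_{15}=\Phi_{16}=PB_1,\quad \Psi_{16}=\Phi_{17}=PB_2KD_2+C_1^TD_1KD_2,\quad \Psi_{17}=\Phi_{18}=A^TH,\\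 \Psi_{22}=\Phi_{22}=a(S_1-S_0-R_0)-bR_1,\quad \Psi_{23}=bG_1,\quad \Psi_{24}=b(R_1-G_1),\\ \Psi_{33}=\Phi_{33}=-b(R_1+S_1),\quad \Psi_{34}=b(R_1-G_1^T),\quad \Psi_{44}=b(G_1+G_1^T-2R_1)+(D_1KC_2)^TD_1KC_2,\\ \Psi_{46}=(D_1KC_2)^TD_1KD_2,\quad \Psi_{47}=\Phi_{48}=(B_2KC_2)^TH,\quad \Psi_{55}=\Phi_{66}=-\gamma^2I,\quad \Psi_{57}=\Phi_{68}=B_1^TH,\\ \Psi_{66}=(D_1KD_2)^TD_1KD_2-\gamma^2I,\quad \Psi_{67}=\Phi_{78}=(B_2KD_2)^TH,\quad \Psi_{77}=\Phi_{88}=-H,\\ \Phi_{12}=aG_0,\quad \Phi_{14}=PB_2KC_2+a(R_0-G_0)+C_1^TD_1KC_2,\quad \Phi_{15}=PB_2K+C_1^TD_1K,\\ \Phi_{23}=bR_1,\quad \Phi_{24}=a(R_0-G_0^T),\quad \Phi_{44}=a(G_0+G_0^T-2R_0)+(D_1KC_2)^TD_1KC_2+\varepsilon C_2^T\Omega C_2,\\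 \Phi_{45}=(D_1KC_2)^TD_1K,\quad \Phi_{47}=(D_1KC_2)^TD_1KD_2+\varepsilon C_2^T\Omega D_2,\quad \Phi_{55}=(D_1K)^TD_1K-\Omega,\\ \Phi_{57}=(D_1K)^TD_1KD_2,\quad \Phi_{58}=(B_2K)^TH,\quad \Phi_{77}=(D_1KD_2)^TD_1KD_2+\varepsilon D_2^T\Omega D_2-\gamma^2I, \end{array}$$ all other blocks above the diagonal being zero. Then the closed loop under the switching event-trigger with this $\Omega$ is internally exponentially stable with decay rate $\delta$ and has $L_2$-gain less than $\gamma$. -/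

import Mathlib

open Matrix MeasureTheory Filter

namespace EventTrigger

/-- Data of the networked control loop
`ẋ = A x + B₁ w + B₂ u`, `z = C₁ x + D₁ u`, `y = C₂ x + D₂ v`, with output-feedback gain `K`. -/
structure Plant (n m nz l nw nv : ℕ) where
  A : Matrix (Fin n) (Fin n) ℝ
  B₁ : Matrix (Fin n) (Fin nw) ℝ
  B₂ : Matrix (Fin n) (Fin m) ℝ
  C₁ : Matrix (Fin nz) (Fin n) ℝ
  D₁ : Matrix (Fin nz) (Fin m) ℝ
  C₂ : Matrix (Fin l) (Fin n) ℝ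
  D₂ : Matrix (Fin l) (Fin nv) ℝ
  K : Matrix (Fin m) (Fin l) ℝ

/-- A signal belongs to `L₂[0, ∞)` (with respect to the Euclidean norm). -/
def SquareIntegrable {d : ℕ} (f : ℝ → Fin d → ℝ) : Prop :=
  MemLp (fun t => WithLp.toLp 2 (f t)) 2 (volume.restrict (Set.Ici (0 : ℝ)))

/-- Updating time of the zero-order hold: `t_k = s_k + η_k`. -/
def updateTime (s η : ℕ → ℝ) (k : ℕ) : ℝ := s k + η k

/-- Network-induced delays in `[0, ηM]` for which the updating times do not decrease. -/
structure AdmissibleDelays (ηM : ℝ) (s η : ℕ → ℝ) : Prop where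
  nonneg : ∀ k, 0 ≤ η k
  le_max : ∀ k, η k ≤ ηM
  updateTime_le : ∀ k, updateTime s η k ≤ updateTime s η (k + 1)

/-- The switching event-trigger: `s₀ = 0` and `s_{k+1}` is the minimum of the times `r ≥ s_k + h`
with `(y(r) - y(s_k))ᵀ Ω (y(r) - y(s_k)) ≥ ε y(r)ᵀ Ω y(r)`. -/
structure IsSampling {l : ℕ} (h ε : ℝ) (Ω : Matrix (Fin l) (Fin l) ℝ)
    (y : ℝ → Fin l → ℝ) (s : ℕ → ℝ) : Prop where
  zero : s 0 = 0
  next : ∀ k, IsLeast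
    {r : ℝ | s k + h ≤ r ∧
      (y r - y (s k)) ⬝ᵥ (Ω *ᵥ (y r - y (s k))) ≥ ε * (y r ⬝ᵥ (Ω *ᵥ y r))}
    (s (k + 1))

/-- The delay `τ(t)` for `t ∈ [t_k, t_{k+1})`.  For `t < t_k + h` it is `t - s_k`.
For `t ≥ t_k + h` it is the fictitious delay, which interpolates linearly between `η_k` at
`t_k + h` and `η_{k+1}` at `t_{k+1}`, so that `t - τ(t)` runs through `[s_k + h, s_{k+1})`.
If the latter interval is empty, i.e. `s_{k+1} = s_k + h`, the event-trigger mode does not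
occur and `τ(t) = t - s_k` on the whole of `[t_k, t_{k+1})`. -/
noncomputable def delayOn (h : ℝ) (s η : ℕ → ℝ) (k : ℕ) (t : ℝ) : ℝ :=
  open scoped Classical in
  if t < updateTime s η k + h ∨ s (k + 1) ≤ s k + h then t - s k
  else
    (updateTime s η (k + 1) - t) / (updateTime s η (k + 1) - updateTime s η k - h) * η k
      + (t - updateTime s η k - h) / (updateTime s η (k + 1) - updateTime s η k - h) * η (k + 1)

/-- `τ` is the time delay of the closed loop on `[t₀, ∞)`. -/
def IsDelay (h : ℝ) (s η : ℕ → ℝ) (τ : ℝ → ℝ) : Prop :=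
  ∀ k, ∀ t ∈ Set.Ico (updateTime s η k) (updateTime s η (k + 1)), τ t = delayOn h s η k t

/-- The delayed measurement noise `v(t - τ(t))`, `t ≥ t₀`; it is zero for `t < t₀`, when no
measurement has reached the actuator yet. -/
noncomputable def delayedNoise {nv : ℕ} (s η : ℕ → ℝ) (τ : ℝ → ℝ) (v : ℝ → Fin nv → ℝ) :
    ℝ → Fin nv → ℝ :=
  (Set.Ici (updateTime s η 0)).indicator fun t => v (t - τ t)

variable {n m nz l nw nv : ℕ}

/-- The measurement `y = C₂ x + D₂ v`. -/
def Plant.measurement (p : Plant n m nz l nw nv) (x : ℝ → Fin n → ℝ) (v : ℝ → Fin nv → ℝ)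
    (t : ℝ) : Fin l → ℝ :=
  p.C₂ *ᵥ x t + p.D₂ *ᵥ v t

/-- The controlled output `z = C₁ x + D₁ u`. -/
def Plant.controlled (p : Plant n m nz l nw nv) (x : ℝ → Fin n → ℝ) (u : ℝ → Fin m → ℝ)
    (t : ℝ) : Fin nz → ℝ :=
  p.C₁ *ᵥ x t + p.D₁ *ᵥ u t

/-- The right-hand side of the state equation. -/
def Plant.rhs (p : Plant n m nz l nw nv) (w : ℝ → Fin nw → ℝ) (x : ℝ → Fin n → ℝ)
    (u : ℝ → Fin m → ℝ) (t : ℝ) : Fin n → ℝ :=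
  p.A *ᵥ x t + p.B₁ *ᵥ w t + p.B₂ *ᵥ u t

/-- Trajectories of the closed loop on `[0, ∞)` under the switching event-trigger with
network-induced delays: the state equation holds in the sense of Carathéodory, the held input is
`K y(s_k)` on `[t_k, t_{k+1})`, and it is zero before the first update `t₀`. -/
structure IsTrajectory (p : Plant n m nz l nw nv) (h ε ηM : ℝ) (Ω : Matrix (Fin l) (Fin l) ℝ)
    (w : ℝ → Fin nw → ℝ) (v : ℝ → Fin nv → ℝ) (s η : ℕ → ℝ)
    (x : ℝ → Fin n → ℝ) (u : ℝ → Fin m → ℝ) : Prop where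
  delays : AdmissibleDelays ηM s η
  sampling : IsSampling h ε Ω (p.measurement x v) s
  input_before : ∀ t < updateTime s η 0, u t = 0
  input_held : ∀ k, ∀ t ∈ Set.Ico (updateTime s η k) (updateTime s η (k + 1)),
    u t = p.K *ᵥ p.measurement x v (s k)
  integrable : ∀ t, 0 ≤ t → IntervalIntegrable (p.rhs w x u) volume 0 t
  state : ∀ t, 0 ≤ t → x t = x 0 + ∫ r in (0 : ℝ)..t, p.rhs w x u r

/-- Internal exponential stability with decay rate `δ`: for `w = 0`, `v = 0` every trajectory
satisfies `|x(t)| ≤ M e^{-δ t} |x(0)|`, with `M` independent of the trajectory, of the sampling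
instants and of the network-induced delays. -/
def InternallyExpStable (p : Plant n m nz l nw nv) (h ε ηM : ℝ) (Ω : Matrix (Fin l) (Fin l) ℝ)
    (δ : ℝ) : Prop :=
  ∃ M : ℝ, 0 < M ∧ ∀ (s η : ℕ → ℝ) (x : ℝ → Fin n → ℝ) (u : ℝ → Fin m → ℝ),
    IsTrajectory p h ε ηM Ω 0 0 s η x u →
      ∀ t, 0 ≤ t →
        ‖WithLp.toLp 2 (x t)‖ ≤ M * Real.exp (-δ * t) * ‖WithLp.toLp 2 (x 0)‖

/-- The total disturbance `wᵀ(t) w(t) + vᵀ(t - τ(t)) v(t - τ(t))`. -/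
noncomputable def disturbance (s η : ℕ → ℝ) (τ : ℝ → ℝ) (w : ℝ → Fin nw → ℝ)
    (v : ℝ → Fin nv → ℝ) (t : ℝ) : ℝ :=
  w t ⬝ᵥ w t + delayedNoise s η τ v t ⬝ᵥ delayedNoise s η τ v t

/-- The integrand `zᵀ z - γ² [wᵀ w + vᵀ(t - τ(t)) v(t - τ(t))]` of the performance index `J`. -/
noncomputable def gainIntegrand (p : Plant n m nz l nw nv) (γ : ℝ) (s η : ℕ → ℝ) (τ : ℝ → ℝ)
    (w : ℝ → Fin nw → ℝ) (v : ℝ → Fin nv → ℝ) (x : ℝ → Fin n → ℝ) (u : ℝ → Fin m → ℝ)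
    (t : ℝ) : ℝ :=
  p.controlled x u t ⬝ᵥ p.controlled x u t - γ ^ 2 * disturbance s η τ w v t

/-- `L₂`-gain less than `γ`: for `x(0) = 0` and all `w, v ∈ L₂[0, ∞)` with a total disturbance
that does not vanish almost everywhere, `J < 0`.  Since `v(t - τ(t))` may fail to be square
integrable for `v ∈ L₂`, `J < 0` is stated for the improper integral (its upper limit is negative),
and moreover as a Lebesgue integral over `[0, ∞)` whenever `v(t - τ(t))` is in `L₂`. -/
def L2GainLT (p : Plant n m nz l nw nv) (h ε ηM : ℝ) (Ω : Matrix (Fin l) (Fin l) ℝ)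
    (γ : ℝ) : Prop :=
  ∀ (w : ℝ → Fin nw → ℝ) (v : ℝ → Fin nv → ℝ) (s η : ℕ → ℝ) (τ : ℝ → ℝ)
    (x : ℝ → Fin n → ℝ) (u : ℝ → Fin m → ℝ),
    SquareIntegrable w → SquareIntegrable v →
    IsTrajectory p h ε ηM Ω w v s η x u → IsDelay h s η τ → x 0 = 0 →
    ¬ (disturbance s η τ w v =ᵐ[volume.restrict (Set.Ici (0 : ℝ))] 0) →
      (∀ T, 0 ≤ T → IntervalIntegrable (gainIntegrand p γ s η τ w v x u) volume 0 T) ∧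
      (∃ c : ℝ, 0 < c ∧ ∀ᶠ T in atTop,
        ∫ t in (0 : ℝ)..T, gainIntegrand p γ s η τ w v x u t ≤ -c) ∧
      (SquareIntegrable (delayedNoise s η τ v) →
        IntegrableOn (gainIntegrand p γ s η τ w v x u) (Set.Ici 0) ∧
        ∫ t in Set.Ici (0 : ℝ), gainIntegrand p γ s η τ w v x u t < 0)

/-- The symmetric block matrix with first diagonal block `a`, first row `[a, b]`, and lower right
block `M`.  Iterated, it builds a symmetric block matrix from the rows of its upper triangle. -/
def symBlock {α β : Type} (a : Matrix α α ℝ) (b : Matrix α β ℝ) (M : Matrix β β ℝ) :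
    Matrix (α ⊕ β) (α ⊕ β) ℝ :=
  Matrix.fromBlocks a b bᵀ M

/-- Horizontal concatenation of blocks. -/
infixr:55 " ⊞ " => Matrix.fromCols

/-- `H = ηM² R₀ + h² R₁`. -/
def matH (h ηM : ℝ) (R₀ R₁ : Matrix (Fin n) (Fin n) ℝ) : Matrix (Fin n) (Fin n) ℝ :=
  ηM ^ 2 • R₀ + h ^ 2 • R₁

/-- The symmetric matrix `Ψ`, given by the rows of its upper triangle;
`a = e^{-2 δ ηM}`, `b = e^{-2 δ τM}`, `τM = h + ηM`. -/
noncomputable def matΨ (p : Plant n m nz l nw nv) (γ h ηM δ : ℝ)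
    (P S₀ S₁ R₀ R₁ G₁ : Matrix (Fin n) (Fin n) ℝ) :
    Matrix (Fin n ⊕ Fin n ⊕ Fin n ⊕ Fin n ⊕ Fin nw ⊕ Fin nv ⊕ Fin n)
      (Fin n ⊕ Fin n ⊕ Fin n ⊕ Fin n ⊕ Fin nw ⊕ Fin nv ⊕ Fin n) ℝ :=
  let a : ℝ := Real.exp (-2 * δ * ηM)
  let b : ℝ := Real.exp (-2 * δ * (h + ηM))
  let H := matH h ηM R₀ R₁
  let BKC := p.B₂ * p.K * p.C₂
  let BKD := p.B₂ * p.K * p.D₂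
  let DKC := p.D₁ * p.K * p.C₂
  let DKD := p.D₁ * p.K * p.D₂
  symBlock (p.Aᵀ * P + P * p.A + (2 * δ) • P + S₀ - a • R₀ + p.C₁ᵀ * p.C₁)
    (a • R₀ ⊞ 0 ⊞ (P * BKC + p.C₁ᵀ * DKC) ⊞ (P * p.B₁) ⊞ (P * BKD + p.C₁ᵀ * DKD)
      ⊞ (p.Aᵀ * H)) <|
  symBlock (a • (S₁ - S₀ - R₀) - b • R₁)
    (b • G₁ ⊞ b • (R₁ - G₁) ⊞ 0 ⊞ 0 ⊞ 0) <|
  symBlock (-(b • (R₁ + S₁)))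
    (b • (R₁ - G₁ᵀ) ⊞ 0 ⊞ 0 ⊞ 0) <|
  symBlock (b • (G₁ + G₁ᵀ - (2 : ℝ) • R₁) + DKCᵀ * DKC)
    (0 ⊞ (DKCᵀ * DKD) ⊞ (BKCᵀ * H)) <|
  symBlock (-(γ ^ 2 • (1 : Matrix (Fin nw) (Fin nw) ℝ)))
    (0 ⊞ (p.B₁ᵀ * H)) <|
  symBlock (DKDᵀ * DKD - γ ^ 2 • (1 : Matrix (Fin nv) (Fin nv) ℝ))
    (BKDᵀ * H)
    (-H)

/-- The symmetric matrix `Φ`, given by the rows of its upper triangle;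
`a = e^{-2 δ ηM}`, `b = e^{-2 δ τM}`, `τM = h + ηM`. -/
noncomputable def matΦ (p : Plant n m nz l nw nv) (γ h ηM ε δ : ℝ)
    (P S₀ S₁ R₀ R₁ G₀ : Matrix (Fin n) (Fin n) ℝ) (Ω : Matrix (Fin l) (Fin l) ℝ) :
    Matrix (Fin n ⊕ Fin n ⊕ Fin n ⊕ Fin n ⊕ Fin l ⊕ Fin nw ⊕ Fin nv ⊕ Fin n)
      (Fin n ⊕ Fin n ⊕ Fin n ⊕ Fin n ⊕ Fin l ⊕ Fin nw ⊕ Fin nv ⊕ Fin n) ℝ :=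
  let a : ℝ := Real.exp (-2 * δ * ηM)
  let b : ℝ := Real.exp (-2 * δ * (h + ηM))
  let H := matH h ηM R₀ R₁
  let BK := p.B₂ * p.K
  let DK := p.D₁ * p.K
  let BKC := p.B₂ * p.K * p.C₂
  let BKD := p.B₂ * p.K * p.D₂
  let DKC := p.D₁ * p.K * p.C₂
  let DKD := p.D₁ * p.K * p.D₂
  symBlock (p.Aᵀ * P + P * p.A + (2 * δ) • P + S₀ - a • R₀ + p.C₁ᵀ * p.C₁)
    (a • G₀ ⊞ 0 ⊞ (P * BKC + a • (R₀ - G₀) + p.C₁ᵀ * DKC) ⊞ (P * BK + p.C₁ᵀ * DK)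
      ⊞ (P * p.B₁) ⊞ (P * BKD + p.C₁ᵀ * DKD) ⊞ (p.Aᵀ * H)) <|
  symBlock (a • (S₁ - S₀ - R₀) - b • R₁)
    (b • R₁ ⊞ a • (R₀ - G₀ᵀ) ⊞ 0 ⊞ 0 ⊞ 0 ⊞ 0) <|
  symBlock (-(b • (R₁ + S₁)))
    (0 ⊞ 0 ⊞ 0 ⊞ 0 ⊞ 0) <|
  symBlock (a • (G₀ + G₀ᵀ - (2 : ℝ) • R₀) + DKCᵀ * DKC + ε • (p.C₂ᵀ * Ω * p.C₂))
    ((DKCᵀ * DK) ⊞ 0 ⊞ (DKCᵀ * DKD + ε • (p.C₂ᵀ * Ω * p.D₂)) ⊞ (BKCᵀ * H)) <|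
  symBlock (DKᵀ * DK - Ω)
    (0 ⊞ (DKᵀ * DKD) ⊞ (BKᵀ * H)) <|
  symBlock (-(γ ^ 2 • (1 : Matrix (Fin nw) (Fin nw) ℝ)))
    (0 ⊞ (p.B₁ᵀ * H)) <|
  symBlock (DKDᵀ * DKD + ε • (p.D₂ᵀ * Ω * p.D₂) - γ ^ 2 • (1 : Matrix (Fin nv) (Fin nv) ℝ))
    (BKDᵀ * H)
    (-H)

end EventTrigger

/-! ### Locally absolutely continuous functions and sliding-window integrals. -/

namespace EventTrigger

/-! The proof is a Lyapunov-Krasovskii argument. Let `V` be `xᵀPx` plus exponentially weighted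
integrals of `xᵀS₀x`, `xᵀS₁x` and double integrals of `ẋᵀR₀ẋ`, `ẋᵀR₁ẋ` over the windows `[t-ηM, t]`
and `[t-τM, t-ηM]`, and put `W = e^{2δt} V`. The core (`dissipation`) is `W' ≤ e^{2δt}(γ²|d|² -
|z|²)` after the first update, `d` being the total disturbance.

At each such time the input is `K` times the output at `q = t-τ(t)`, plus an error `e`. In sampling
mode `q = s_k` and `e = 0`: if `q` lies in the older window, `Ψ ≤ 0` applies, otherwise `Φ ≤ 0`. In
event-trigger mode the fictitious delay keeps `q` in `[s_k+h, s_{k+1})` and at most `ηM` behind `t`;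
then `Φ ≤ 0` applies with `e = y(s_k) - y(q)`, and the untriggered condition gives `eᵀΩe < ε
y(q)ᵀΩy(q)`. The negative integrals in `W'` are bounded by Jensen's inequality, and by
`reciprocally_convex` on the window that contains `q`. Evaluating the forms with `ẋ` in the last
block replaces a Schur complement, so `H` may be singular.

Before the first update the zero input is matched by `q = 0`, `e = -C₂x(0)`. This costs a multiple
of `|x(0)|²` over a time at most `ηM`, and nothing when `x(0) = 0`. Stability follows from `W` and
the coercivity of `P`.

For the gain, `V' + 2δV + |z|² - γ²|d|² ≤ 0` is integrated. The matrix inequalities are not strict,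
so strictness has two sources: the term `2δ∫xᵀPx` if the state is not identically zero; otherwise a
pointwise strict inequality, from `feedthrough_lt` or from the strict trigger bound
(`gainIntegrand_of_state_zero`). -/

/-- `F` is locally absolutely continuous with almost everywhere derivative `f`. -/
structure IsPrimitive (F f : ℝ → ℝ) : Prop where
  ac : ∀ a b, AbsolutelyContinuousOnInterval F a b
  ae_deriv : ∀ᵐ t, HasDerivAt F (f t) t

namespace IsPrimitive

variable {F G f g : ℝ → ℝ}

theorem of_integral (hf : ∀ a b, IntervalIntegrable f volume a b)
    (hF : ∀ t, F t = F 0 + ∫ r in (0 : ℝ)..t, f r) : IsPrimitive F f := by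
  have hF' : F = fun t => F 0 + ∫ r in (0 : ℝ)..t, f r := funext hF
  constructor
  · intro a b
    rw [hF']
    -- The interval is enlarged to contain the base point `0` of the primitive.
    have h := (hf (min a 0 ⊓ b) (max a 0 ⊔ b)).absolutelyContinuousOnInterval_intervalIntegral
      (c := 0) (by rw [Set.mem_uIcc]; left; simp)
    have h1 : AbsolutelyContinuousOnInterval (fun _ : ℝ => F 0) (min a 0 ⊓ b) (max a 0 ⊔ b) :=
      (LipschitzWith.const (F 0)).lipschitzOnWith.absolutelyContinuousOnInterval
    refine (h1.add h).mono ?_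
    refine Set.uIcc_subset_uIcc ?_ ?_ <;> rw [Set.mem_uIcc] <;> left <;> simp
  · have hl : LocallyIntegrable f volume := by
      refine fun t => ⟨Set.Ioc (t - 1) (t + 1), Ioc_mem_nhds (by linarith) (by linarith), ?_⟩
      exact (intervalIntegrable_iff_integrableOn_Ioc_of_le (by linarith)).1 (hf _ _)
    filter_upwards [LocallyIntegrable.ae_hasDerivAt_integral hl] with t ht
    rw [hF']
    exact (ht 0).const_add (F 0)

theorem of_hasDerivAt (h : ∀ t, HasDerivAt F (f t) t) (hf : Continuous f) : IsPrimitive F f := by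
  refine of_integral (fun a b => hf.intervalIntegrable a b) fun t => ?_
  rw [intervalIntegral.integral_eq_sub_of_hasDerivAt (fun s _ => h s) (hf.intervalIntegrable _ _)]
  ring

theorem continuous (h : IsPrimitive F f) : Continuous F := by
  refine continuous_iff_continuousAt.2 fun t => ?_
  exact (h.ac (t - 1) (t + 1)).continuousOn.continuousAt (by
    rw [Set.uIcc_of_le (by linarith)]; exact Icc_mem_nhds (by linarith) (by linarith))

theorem intervalIntegrable (h : IsPrimitive F f) (a b : ℝ) : IntervalIntegrable f volume a b := by
  refine (h.ac a b).intervalIntegrable_deriv.congr_ae ?_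
  filter_upwards [ae_restrict_of_ae h.ae_deriv] with t ht using ht.deriv

theorem integral_eq (h : IsPrimitive F f) (a b : ℝ) : ∫ t in a..b, f t = F b - F a := by
  rw [← (h.ac a b).integral_deriv_eq_sub]
  refine intervalIntegral.integral_congr_ae ?_
  filter_upwards [h.ae_deriv] with t ht _ using ht.deriv.symm

theorem add (hF : IsPrimitive F f) (hG : IsPrimitive G g) :
    IsPrimitive (fun t => F t + G t) (fun t => f t + g t) :=
  ⟨fun a b => (hF.ac a b).add (hG.ac a b), by
    filter_upwards [hF.ae_deriv, hG.ae_deriv] with t h1 h2 using h1.add h2⟩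

theorem sub (hF : IsPrimitive F f) (hG : IsPrimitive G g) :
    IsPrimitive (fun t => F t - G t) (fun t => f t - g t) :=
  ⟨fun a b => (hF.ac a b).sub (hG.ac a b), by
    filter_upwards [hF.ae_deriv, hG.ae_deriv] with t h1 h2 using h1.sub h2⟩

theorem mul (hF : IsPrimitive F f) (hG : IsPrimitive G g) :
    IsPrimitive (fun t => F t * G t) (fun t => f t * G t + F t * g t) :=
  ⟨fun a b => (hF.ac a b).fun_mul (hG.ac a b), by
    filter_upwards [hF.ae_deriv, hG.ae_deriv] with t h1 h2 using h1.mul h2⟩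

theorem const_mul (c : ℝ) (hF : IsPrimitive F f) :
    IsPrimitive (fun t => c * F t) (fun t => c * f t) :=
  ⟨fun a b => (hF.ac a b).const_mul c, by
    filter_upwards [hF.ae_deriv] with t h1 using h1.const_mul c⟩

theorem zero : IsPrimitive (fun _ => 0) (fun _ => 0) :=
  of_hasDerivAt (fun t => hasDerivAt_const t 0) continuous_const

theorem sum {ι : Type*} (s : Finset ι) {F f : ι → ℝ → ℝ} (h : ∀ i, IsPrimitive (F i) (f i)) :
    IsPrimitive (fun t => ∑ i ∈ s, F i t) (fun t => ∑ i ∈ s, f i t) := by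
  classical
  induction s using Finset.induction_on with
  | empty => simpa using zero
  | insert i s hi ih => simpa [Finset.sum_insert hi] using (h i).add ih

theorem congr_deriv (hF : IsPrimitive F f) (h : ∀ t, f t = g t) : IsPrimitive F g := by
  rwa [← funext h]

/-- The integral of a continuous function over a sliding window. -/
theorem window {k : ℝ → ℝ} (hk : Continuous k) (c d : ℝ) :
    IsPrimitive (fun t => ∫ r in (t - d)..(t - c), k r) (fun t => k (t - c) - k (t - d)) := by
  refine of_hasDerivAt (fun t => ?_) (by fun_prop)
  have key : ∀ c : ℝ, HasDerivAt (fun t => ∫ r in (0 : ℝ)..(t - c), k r) (k (t - c)) t := by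
    intro c
    have h1 := intervalIntegral.integral_hasDerivAt_right (hk.intervalIntegrable 0 (t - c))
      hk.stronglyMeasurable.stronglyMeasurableAtFilter hk.continuousAt
    exact (h1.comp_sub_const t c)
  have h2 := (key c).sub (key d)
  refine h2.congr_of_eventuallyEq (Eventually.of_forall fun t => ?_)
  exact (intervalIntegral.integral_interval_sub_left (hk.intervalIntegrable _ _)
    (hk.intervalIntegrable _ _)).symm

/-- The functional `∫_{-d}^{-c} ∫_{t+θ}^t k(r) dr dθ`, written with a primitive `K` of `k`. -/
theorem doubleWindow {K k : ℝ → ℝ} (hK : IsPrimitive K k) (c d : ℝ) :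
    IsPrimitive (fun t => ∫ r in (t - d)..(t - c), (K t - K r))
      (fun t => (d - c) * k t - ∫ r in (t - d)..(t - c), k r) := by
  have h := (hK.const_mul (d - c)).sub (window hK.continuous c d)
  -- Splitting off `(d - c) K(t)` leaves a window integral of the continuous function `K`, so `k`
  -- itself need not be continuous.
  have e : (fun t => ∫ r in (t - d)..(t - c), (K t - K r)) =
      fun t => (d - c) * K t - ∫ r in (t - d)..(t - c), K r := by
    funext t
    rw [intervalIntegral.integral_sub intervalIntegrable_const
      (hK.continuous.intervalIntegrable _ _)]
    simp
  rw [e]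
  exact h.congr_deriv fun t => by rw [hK.integral_eq]

end IsPrimitive

end EventTrigger

/-! ### Quadratic forms of `Ψ` and `Φ`, and inequalities for positive matrices. -/

namespace EventTrigger

theorem symBlock_quad {α β : Type} [Fintype α] [Fintype β] (a : Matrix α α ℝ) (b : Matrix α β ℝ)
    (M : Matrix β β ℝ) (x : α → ℝ) (y : β → ℝ) :
    Sum.elim x y ⬝ᵥ (symBlock a b M *ᵥ Sum.elim x y) =
      x ⬝ᵥ (a *ᵥ x) + 2 * (x ⬝ᵥ (b *ᵥ y)) + y ⬝ᵥ (M *ᵥ y) := by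
  have h : y ⬝ᵥ (bᵀ *ᵥ x) = x ⬝ᵥ (b *ᵥ y) := by
    rw [mulVec_transpose, dotProduct_comm, dotProduct_mulVec]
  rw [symBlock, fromBlocks_mulVec, sumElim_dotProduct_sumElim]
  simp only [Sum.elim_comp_inl, Sum.elim_comp_inr, dotProduct_add, h]
  ring

theorem dotProduct_transpose_mulVec {α β : Type*} [Fintype α] [Fintype β] (M : Matrix α β ℝ)
    (x : β → ℝ) (y : α → ℝ) : x ⬝ᵥ (Mᵀ *ᵥ y) = (M *ᵥ x) ⬝ᵥ y := by
  rw [mulVec_transpose, dotProduct_comm, ← dotProduct_mulVec, dotProduct_comm]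

theorem dotProduct_mulVec_comm_of_isSymm {α : Type*} [Fintype α] {M : Matrix α α ℝ}
    (hM : M.IsSymm) (x y : α → ℝ) : x ⬝ᵥ (M *ᵥ y) = y ⬝ᵥ (M *ᵥ x) := by
  rw [← hM, dotProduct_transpose_mulVec, hM, dotProduct_comm]

theorem PosSemidef_isSymm {α : Type*} {M : Matrix α α ℝ} (hM : M.PosSemidef) : M.IsSymm := by
  have := hM.isHermitian
  rwa [IsHermitian, conjTranspose_eq_transpose_of_trivial] at this

theorem PosSemidef_quad_nonneg {α : Type*} [Fintype α] {M : Matrix α α ℝ} (hM : M.PosSemidef)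
    (x : α → ℝ) : 0 ≤ x ⬝ᵥ (M *ᵥ x) := by
  simpa using hM.dotProduct_mulVec_nonneg x

variable {n m nz l nw nv : ℕ}

/-- This is the form of `-Ψ` at `(x₁, x₂, x₃, x₄, w, v, f)`. Along a trajectory the entries are the
state at `t`, `t-ηM`, `t-τM` and `t-τ(t)`, the two disturbances, and `ẋ(t)`. -/
theorem matΨ_dissipation (p : Plant n m nz l nw nv) {γ h ηM δ : ℝ}
    {P S₀ S₁ R₀ R₁ G₁ : Matrix (Fin n) (Fin n) ℝ}
    (hP : P.IsSymm) (hR₀ : R₀.IsSymm) (hR₁ : R₁.IsSymm)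
    (hΨ : (-matΨ p γ h ηM δ P S₀ S₁ R₀ R₁ G₁).PosSemidef)
    (x₁ x₂ x₃ x₄ f : Fin n → ℝ) (w : Fin nw → ℝ) (v : Fin nv → ℝ) (u : Fin m → ℝ)
    (hu : u = p.K *ᵥ (p.C₂ *ᵥ x₄ + p.D₂ *ᵥ v))
    (hf : f = p.A *ᵥ x₁ + p.B₁ *ᵥ w + p.B₂ *ᵥ u) :
    2 * (x₁ ⬝ᵥ (P *ᵥ f)) + 2 * δ * (x₁ ⬝ᵥ (P *ᵥ x₁)) + x₁ ⬝ᵥ (S₀ *ᵥ x₁)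
      + Real.exp (-2 * δ * ηM) * (x₂ ⬝ᵥ (S₁ *ᵥ x₂) - x₂ ⬝ᵥ (S₀ *ᵥ x₂))
      - Real.exp (-2 * δ * (h + ηM)) * (x₃ ⬝ᵥ (S₁ *ᵥ x₃))
      + f ⬝ᵥ (matH h ηM R₀ R₁ *ᵥ f)
      - Real.exp (-2 * δ * ηM) * ((x₁ - x₂) ⬝ᵥ (R₀ *ᵥ (x₁ - x₂)))
      - Real.exp (-2 * δ * (h + ηM)) * ((x₂ - x₄) ⬝ᵥ (R₁ *ᵥ (x₂ - x₄))
        + (x₄ - x₃) ⬝ᵥ (R₁ *ᵥ (x₄ - x₃)) + 2 * ((x₂ - x₄) ⬝ᵥ (G₁ *ᵥ (x₄ - x₃))))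
      + (p.C₁ *ᵥ x₁ + p.D₁ *ᵥ u) ⬝ᵥ (p.C₁ *ᵥ x₁ + p.D₁ *ᵥ u)
      - γ ^ 2 * (w ⬝ᵥ w + v ⬝ᵥ v) ≤ 0 := by
  have key := PosSemidef_quad_nonneg hΨ
    (Sum.elim x₁ (Sum.elim x₂ (Sum.elim x₃ (Sum.elim x₄ (Sum.elim w (Sum.elim v f))))))
  -- The last block column contributes `2 fᵀHf - fᵀHf`, because the blocks above `-H` reassemble
  -- `f`; this does the work of a Schur complement.
  have hH : f ⬝ᵥ (matH h ηM R₀ R₁ *ᵥ f) =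
      2 * ((p.A *ᵥ x₁) ⬝ᵥ (matH h ηM R₀ R₁ *ᵥ f) + (p.B₁ *ᵥ w) ⬝ᵥ (matH h ηM R₀ R₁ *ᵥ f)
        + (p.B₂ *ᵥ p.K *ᵥ p.C₂ *ᵥ x₄) ⬝ᵥ (matH h ηM R₀ R₁ *ᵥ f)
        + (p.B₂ *ᵥ p.K *ᵥ p.D₂ *ᵥ v) ⬝ᵥ (matH h ηM R₀ R₁ *ᵥ f))
        - f ⬝ᵥ (matH h ηM R₀ R₁ *ᵥ f) := by
    have : f ⬝ᵥ (matH h ηM R₀ R₁ *ᵥ f) = (p.A *ᵥ x₁) ⬝ᵥ (matH h ηM R₀ R₁ *ᵥ f)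
        + (p.B₁ *ᵥ w) ⬝ᵥ (matH h ηM R₀ R₁ *ᵥ f)
        + (p.B₂ *ᵥ p.K *ᵥ p.C₂ *ᵥ x₄) ⬝ᵥ (matH h ηM R₀ R₁ *ᵥ f)
        + (p.B₂ *ᵥ p.K *ᵥ p.D₂ *ᵥ v) ⬝ᵥ (matH h ηM R₀ R₁ *ᵥ f) := by
      conv_lhs => rw [show f ⬝ᵥ (matH h ηM R₀ R₁ *ᵥ f)
        = (p.A *ᵥ x₁ + p.B₁ *ᵥ w + p.B₂ *ᵥ u) ⬝ᵥ (matH h ηM R₀ R₁ *ᵥ f) by rw [← hf], hu]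
      simp only [mulVec_add, add_dotProduct]
      ring
    linarith
  have hxf : x₁ ⬝ᵥ (P *ᵥ f) = x₁ ⬝ᵥ (P *ᵥ p.A *ᵥ x₁) + x₁ ⬝ᵥ (P *ᵥ p.B₁ *ᵥ w)
      + x₁ ⬝ᵥ (P *ᵥ p.B₂ *ᵥ p.K *ᵥ p.C₂ *ᵥ x₄) + x₁ ⬝ᵥ (P *ᵥ p.B₂ *ᵥ p.K *ᵥ p.D₂ *ᵥ v) := by
    rw [hf, hu]
    simp only [mulVec_add, dotProduct_add]
    ring
  rw [hH, hxf, hu]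
  simp only [matΨ, neg_mulVec, dotProduct_neg, symBlock_quad, fromCols_mulVec_sumElim,
    dotProduct_add, dotProduct_sub, add_dotProduct, sub_dotProduct, mulVec_add, mulVec_sub,
    add_mulVec, sub_mulVec, smul_mulVec, dotProduct_smul, zero_mulVec, dotProduct_zero,
    transpose_mul, ← mulVec_mulVec, dotProduct_transpose_mulVec, smul_eq_mul, one_mulVec] at key ⊢
  rw [dotProduct_mulVec_comm_of_isSymm hP (p.A *ᵥ x₁) x₁] at key
  -- Both sides are now sums of bilinear monomials; the remaining rewrites give each one a single
  -- orientation, so that only linear arithmetic is left.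
  have e1 := dotProduct_mulVec_comm_of_isSymm hR₀ x₂ x₁
  have e2 := dotProduct_mulVec_comm_of_isSymm hR₁ x₄ x₂
  have e3 := dotProduct_mulVec_comm_of_isSymm hR₁ x₄ x₃
  have e4 := dotProduct_comm (G₁ *ᵥ x₄) x₄
  have e5 := dotProduct_comm (G₁ *ᵥ x₃) x₄
  have d1 := dotProduct_comm (p.D₁ *ᵥ p.K *ᵥ p.C₂ *ᵥ x₄) (p.C₁ *ᵥ x₁)
  have d2 := dotProduct_comm (p.D₁ *ᵥ p.K *ᵥ p.D₂ *ᵥ v) (p.C₁ *ᵥ x₁)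
  have d3 := dotProduct_comm (p.D₁ *ᵥ p.K *ᵥ p.D₂ *ᵥ v) (p.D₁ *ᵥ p.K *ᵥ p.C₂ *ᵥ x₄)
  simp only [e1, e2, e3, e4, e5, d1, d2, d3] at key ⊢
  linarith

/-- The counterpart for `-Φ`, with `x₄` in the recent window. The extra block carries the
measurement error `e`, and the `Ω` blocks produce the right-hand side. -/
theorem matΦ_dissipation (p : Plant n m nz l nw nv) {γ h ηM ε δ : ℝ}
    {P S₀ S₁ R₀ R₁ G₀ : Matrix (Fin n) (Fin n) ℝ} {Ω : Matrix (Fin l) (Fin l) ℝ}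
    (hP : P.IsSymm) (hΩ : Ω.IsSymm) (hR₀ : R₀.IsSymm) (hR₁ : R₁.IsSymm)
    (hΦ : (-matΦ p γ h ηM ε δ P S₀ S₁ R₀ R₁ G₀ Ω).PosSemidef)
    (x₁ x₂ x₃ x₄ f : Fin n → ℝ) (w : Fin nw → ℝ) (v : Fin nv → ℝ) (e : Fin l → ℝ)
    (u : Fin m → ℝ) (hu : u = p.K *ᵥ (p.C₂ *ᵥ x₄ + p.D₂ *ᵥ v + e))
    (hf : f = p.A *ᵥ x₁ + p.B₁ *ᵥ w + p.B₂ *ᵥ u) :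
    2 * (x₁ ⬝ᵥ (P *ᵥ f)) + 2 * δ * (x₁ ⬝ᵥ (P *ᵥ x₁)) + x₁ ⬝ᵥ (S₀ *ᵥ x₁)
      + Real.exp (-2 * δ * ηM) * (x₂ ⬝ᵥ (S₁ *ᵥ x₂) - x₂ ⬝ᵥ (S₀ *ᵥ x₂))
      - Real.exp (-2 * δ * (h + ηM)) * (x₃ ⬝ᵥ (S₁ *ᵥ x₃))
      + f ⬝ᵥ (matH h ηM R₀ R₁ *ᵥ f)
      - Real.exp (-2 * δ * ηM) * ((x₁ - x₄) ⬝ᵥ (R₀ *ᵥ (x₁ - x₄))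
        + (x₄ - x₂) ⬝ᵥ (R₀ *ᵥ (x₄ - x₂)) + 2 * ((x₁ - x₄) ⬝ᵥ (G₀ *ᵥ (x₄ - x₂))))
      - Real.exp (-2 * δ * (h + ηM)) * ((x₂ - x₃) ⬝ᵥ (R₁ *ᵥ (x₂ - x₃)))
      + (p.C₁ *ᵥ x₁ + p.D₁ *ᵥ u) ⬝ᵥ (p.C₁ *ᵥ x₁ + p.D₁ *ᵥ u)
      - γ ^ 2 * (w ⬝ᵥ w + v ⬝ᵥ v) ≤ e ⬝ᵥ (Ω *ᵥ e)
        - ε * ((p.C₂ *ᵥ x₄ + p.D₂ *ᵥ v) ⬝ᵥ (Ω *ᵥ (p.C₂ *ᵥ x₄ + p.D₂ *ᵥ v))) := by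
  have key := PosSemidef_quad_nonneg hΦ
    (Sum.elim x₁ (Sum.elim x₂ (Sum.elim x₃ (Sum.elim x₄ (Sum.elim e
      (Sum.elim w (Sum.elim v f)))))))
  have hH : f ⬝ᵥ (matH h ηM R₀ R₁ *ᵥ f) =
      2 * ((p.A *ᵥ x₁) ⬝ᵥ (matH h ηM R₀ R₁ *ᵥ f) + (p.B₁ *ᵥ w) ⬝ᵥ (matH h ηM R₀ R₁ *ᵥ f)
        + (p.B₂ *ᵥ p.K *ᵥ p.C₂ *ᵥ x₄) ⬝ᵥ (matH h ηM R₀ R₁ *ᵥ f)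
        + (p.B₂ *ᵥ p.K *ᵥ p.D₂ *ᵥ v) ⬝ᵥ (matH h ηM R₀ R₁ *ᵥ f)
        + (p.B₂ *ᵥ p.K *ᵥ e) ⬝ᵥ (matH h ηM R₀ R₁ *ᵥ f))
        - f ⬝ᵥ (matH h ηM R₀ R₁ *ᵥ f) := by
    have : f ⬝ᵥ (matH h ηM R₀ R₁ *ᵥ f) = (p.A *ᵥ x₁) ⬝ᵥ (matH h ηM R₀ R₁ *ᵥ f)
        + (p.B₁ *ᵥ w) ⬝ᵥ (matH h ηM R₀ R₁ *ᵥ f)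
        + (p.B₂ *ᵥ p.K *ᵥ p.C₂ *ᵥ x₄) ⬝ᵥ (matH h ηM R₀ R₁ *ᵥ f)
        + (p.B₂ *ᵥ p.K *ᵥ p.D₂ *ᵥ v) ⬝ᵥ (matH h ηM R₀ R₁ *ᵥ f)
        + (p.B₂ *ᵥ p.K *ᵥ e) ⬝ᵥ (matH h ηM R₀ R₁ *ᵥ f) := by
      conv_lhs => rw [show f ⬝ᵥ (matH h ηM R₀ R₁ *ᵥ f)
        = (p.A *ᵥ x₁ + p.B₁ *ᵥ w + p.B₂ *ᵥ u) ⬝ᵥ (matH h ηM R₀ R₁ *ᵥ f) by rw [← hf], hu]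
      simp only [mulVec_add, add_dotProduct]
      ring
    linarith
  have hxf : x₁ ⬝ᵥ (P *ᵥ f) = x₁ ⬝ᵥ (P *ᵥ p.A *ᵥ x₁) + x₁ ⬝ᵥ (P *ᵥ p.B₁ *ᵥ w)
      + x₁ ⬝ᵥ (P *ᵥ p.B₂ *ᵥ p.K *ᵥ p.C₂ *ᵥ x₄) + x₁ ⬝ᵥ (P *ᵥ p.B₂ *ᵥ p.K *ᵥ p.D₂ *ᵥ v)
      + x₁ ⬝ᵥ (P *ᵥ p.B₂ *ᵥ p.K *ᵥ e) := by
    rw [hf, hu]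
    simp only [mulVec_add, dotProduct_add]
    ring
  rw [hH, hxf, hu]
  simp only [matΦ, neg_mulVec, dotProduct_neg, symBlock_quad, fromCols_mulVec_sumElim,
    dotProduct_add, dotProduct_sub, add_dotProduct, sub_dotProduct, mulVec_add, mulVec_sub,
    add_mulVec, sub_mulVec, smul_mulVec, dotProduct_smul, zero_mulVec, dotProduct_zero,
    transpose_mul, ← mulVec_mulVec, dotProduct_transpose_mulVec, smul_eq_mul, one_mulVec] at key ⊢
  rw [dotProduct_mulVec_comm_of_isSymm hP (p.A *ᵥ x₁) x₁] at key
  have e1 := dotProduct_mulVec_comm_of_isSymm hR₀ x₄ x₁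
  have e2 := dotProduct_mulVec_comm_of_isSymm hR₀ x₄ x₂
  have e3 := dotProduct_mulVec_comm_of_isSymm hR₁ x₃ x₂
  have e4 := dotProduct_comm (G₀ *ᵥ x₄) x₄
  have e5 := dotProduct_comm (G₀ *ᵥ x₂) x₄
  have e6 := dotProduct_mulVec_comm_of_isSymm hΩ (p.D₂ *ᵥ v) (p.C₂ *ᵥ x₄)
  have d1 := dotProduct_comm (p.D₁ *ᵥ p.K *ᵥ p.C₂ *ᵥ x₄) (p.C₁ *ᵥ x₁)
  have d2 := dotProduct_comm (p.D₁ *ᵥ p.K *ᵥ p.D₂ *ᵥ v) (p.C₁ *ᵥ x₁)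
  have d3 := dotProduct_comm (p.D₁ *ᵥ p.K *ᵥ p.D₂ *ᵥ v) (p.D₁ *ᵥ p.K *ᵥ p.C₂ *ᵥ x₄)
  have d4 := dotProduct_comm (p.D₁ *ᵥ p.K *ᵥ e) (p.C₁ *ᵥ x₁)
  have d5 := dotProduct_comm (p.D₁ *ᵥ p.K *ᵥ e) (p.D₁ *ᵥ p.K *ᵥ p.C₂ *ᵥ x₄)
  have d6 := dotProduct_comm (p.D₁ *ᵥ p.K *ᵥ p.D₂ *ᵥ v) (p.D₁ *ᵥ p.K *ᵥ e)
  simp only [e1, e2, e3, e4, e5, e6, d1, d2, d3, d4, d5, d6] at key ⊢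
  linarith

theorem matH_posSemidef {h ηM : ℝ} {R₀ R₁ : Matrix (Fin n) (Fin n) ℝ} (hR₀ : R₀.PosSemidef)
    (hR₁ : R₁.PosSemidef) : (matH h ηM R₀ R₁).PosSemidef :=
  (hR₀.smul (sq_nonneg ηM)).add (hR₁.smul (sq_nonneg h))

/-- The feedthrough from the measurement noise to the controlled output has gain less than `γ`. -/
theorem feedthrough_lt (p : Plant n m nz l nw nv) {γ h ηM ε δ : ℝ} (hγ : 0 < γ) (hε : 0 ≤ ε)
    {P S₀ S₁ R₀ R₁ G₀ : Matrix (Fin n) (Fin n) ℝ} {Ω : Matrix (Fin l) (Fin l) ℝ}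
    (hP : P.IsSymm) (hΩ : Ω.PosSemidef) (hR₀ : R₀.PosSemidef) (hR₁ : R₁.PosSemidef)
    (hΦ : (-matΦ p γ h ηM ε δ P S₀ S₁ R₀ R₁ G₀ Ω).PosSemidef)
    {v : Fin nv → ℝ} (hv : v ≠ 0) :
    (p.D₁ *ᵥ p.K *ᵥ p.D₂ *ᵥ v) ⬝ᵥ (p.D₁ *ᵥ p.K *ᵥ p.D₂ *ᵥ v) < γ ^ 2 * (v ⬝ᵥ v) := by
  set N := p.D₁ *ᵥ p.K *ᵥ p.D₂ *ᵥ v with hN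
  have hq := PosSemidef_quad_nonneg hΩ (p.D₂ *ᵥ v)
  set q := (p.D₂ *ᵥ v) ⬝ᵥ (Ω *ᵥ (p.D₂ *ᵥ v)) with hq'
  -- `Φ` is tested at zero states with the error `e = t D₂v`, which scales the input by `1 + t`. The
  -- right side is only of second order in `t`, so equality of gains is impossible.
  have key : ∀ t : ℝ, (1 + t) ^ 2 * (N ⬝ᵥ N) - γ ^ 2 * (v ⬝ᵥ v) ≤ t ^ 2 * q := by
    intro t
    have h1 := matΦ_dissipation p hP (PosSemidef_isSymm hΩ) (PosSemidef_isSymm hR₀)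
      (PosSemidef_isSymm hR₁) hΦ 0 0 0 0 _ 0 v (t • (p.D₂ *ᵥ v)) _ rfl rfl
    have h2 := PosSemidef_quad_nonneg (matH_posSemidef (h := h) (ηM := ηM) hR₀ hR₁)
      (p.A *ᵥ 0 + p.B₁ *ᵥ 0 + p.B₂ *ᵥ p.K *ᵥ (p.C₂ *ᵥ 0 + p.D₂ *ᵥ v + t • (p.D₂ *ᵥ v)))
    simp only [mulVec_zero, zero_add, sub_zero, dotProduct_zero, mul_zero, zero_dotProduct,
      add_zero, ← hq'] at h1 h2
    have h3 : p.D₁ *ᵥ p.K *ᵥ (p.D₂ *ᵥ v + t • (p.D₂ *ᵥ v)) = (1 + t) • N := by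
      rw [hN, add_smul, one_smul]
      simp only [mulVec_add, mulVec_smul]
    rw [h3] at h1
    simp only [smul_dotProduct, dotProduct_smul, mulVec_smul, smul_eq_mul, ← hq'] at h1
    nlinarith [mul_nonneg hε hq]
  have hG : 0 < γ ^ 2 * (v ⬝ᵥ v) := by
    have : 0 < v ⬝ᵥ v := by
      simpa using (dotProduct_star_self_pos_iff (v := v)).2 hv
    positivity
  by_contra! hc
  have hA : 0 < N ⬝ᵥ N := lt_of_lt_of_le hG hc
  -- With `A = |N|²` and `t(q + 1) = A` one has `t²q < tA`, while the negated claim makes the left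
  -- side at least `2tA`.
  have h1 := key (N ⬝ᵥ N / (q + 1))
  set A := N ⬝ᵥ N
  have ht : 0 < A / (q + 1) := by positivity
  have h2 : A / (q + 1) * (q + 1) = A := by field_simp
  set t := A / (q + 1)
  nlinarith [mul_pos ht hA, mul_pos ht ht]

theorem dotProduct_self_nonneg_real {α : Type*} [Fintype α] (x : α → ℝ) : 0 ≤ x ⬝ᵥ x :=
  Finset.sum_nonneg fun i _ => mul_self_nonneg (x i)

theorem exists_quad_le {α : Type*} [Fintype α] (M : Matrix α α ℝ) :
    ∃ C : ℝ, 0 ≤ C ∧ ∀ x : α → ℝ, x ⬝ᵥ (M *ᵥ x) ≤ C * (x ⬝ᵥ x) := by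
  refine ⟨∑ i, ∑ j, |M i j|, by positivity, fun x => ?_⟩
  have hx : ∀ i, x i * x i ≤ x ⬝ᵥ x := fun i =>
    Finset.single_le_sum (f := fun i => x i * x i) (fun i _ => mul_self_nonneg (x i))
      (Finset.mem_univ i)
  have e1 : x ⬝ᵥ (M *ᵥ x) = ∑ i, ∑ j, x i * (M i j * x j) := by
    simp only [dotProduct, mulVec, Finset.mul_sum]
  rw [e1]
  simp only [Finset.sum_mul]
  refine Finset.sum_le_sum fun i _ => Finset.sum_le_sum fun j _ => ?_
  have h1 : x i * (M i j * x j) ≤ |M i j| * (|x i| * |x j|) := by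
    refine (le_abs_self _).trans (le_of_eq ?_)
    rw [abs_mul, abs_mul]
    ring
  have h2 : |x i| * |x j| ≤ x ⬝ᵥ x := by
    have := hx i
    have := hx j
    nlinarith [sq_nonneg (|x i| - |x j|), abs_mul_abs_self (x i), abs_mul_abs_self (x j)]
  exact h1.trans (by gcongr)

theorem sq_le_mul_of_forall_quad_nonneg {A B C : ℝ}
    (h : ∀ s t : ℝ, 0 ≤ s ^ 2 * A + t ^ 2 * C + 2 * (s * t) * B) : B ^ 2 ≤ A * C := by
  have hA : 0 ≤ A := by simpa using h 1 0
  have hC : 0 ≤ C := by simpa using h 0 1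
  rcases hA.eq_or_lt with hA | hA
  -- If `A = 0`, this test vector gives `-(C + 2)B² ≥ 0`, hence `B = 0`.
  · have h1 := h (-(C + 1)) B
    rw [← hA] at h1 ⊢
    nlinarith [sq_nonneg B]
  · have := h B (-A)
    nlinarith

/-- Cauchy-Schwarz in the inner product of `P`, applied to `x` and `P⁻¹x`, gives `|x|⁴ ≤
(xᵀPx)(xᵀP⁻¹x)`; the last factor is at most `C|x|²`. -/
theorem PosDef_coercive {α : Type*} [Fintype α] [DecidableEq α] {P : Matrix α α ℝ}
    (hP : P.PosDef) : ∃ c : ℝ, 0 < c ∧ ∀ x : α → ℝ, c * (x ⬝ᵥ x) ≤ x ⬝ᵥ (P *ᵥ x) := by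
  obtain ⟨C, hC, hCx⟩ := exists_quad_le P⁻¹
  refine ⟨(C + 1)⁻¹, by positivity, fun x => ?_⟩
  have hs := PosSemidef_isSymm hP.posSemidef
  have hx := dotProduct_self_nonneg_real x
  have hPx := PosSemidef_quad_nonneg hP.posSemidef x
  have h1 : (x ⬝ᵥ x) ^ 2 ≤ (x ⬝ᵥ (P *ᵥ x)) * (x ⬝ᵥ (P⁻¹ *ᵥ x)) := by
    refine sq_le_mul_of_forall_quad_nonneg fun s t => ?_
    have h := PosSemidef_quad_nonneg hP.posSemidef (s • x + t • (P⁻¹ *ᵥ x))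
    have hu : P *ᵥ P⁻¹ *ᵥ x = x := by
      rw [mulVec_mulVec, Matrix.mul_nonsing_inv _ ((isUnit_iff_isUnit_det _).1 hP.isUnit),
        one_mulVec]
    simp only [mulVec_add, mulVec_smul, hu, dotProduct_add, add_dotProduct, dotProduct_smul,
      smul_dotProduct, smul_eq_mul] at h
    rw [dotProduct_mulVec_comm_of_isSymm hs (P⁻¹ *ᵥ x) x, hu, dotProduct_comm (P⁻¹ *ᵥ x) x] at h
    linarith
  have h2 := hCx x
  rw [inv_mul_le_iff₀ (by positivity)]
  rcases hx.eq_or_lt with h0 | h0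
  · rw [← h0]; positivity
  · have h3 : (x ⬝ᵥ x) * (x ⬝ᵥ x) ≤ ((C + 1) * (x ⬝ᵥ (P *ᵥ x))) * (x ⬝ᵥ x) := by
      nlinarith [mul_le_mul_of_nonneg_left h2 hPx, mul_nonneg hPx hx]
    exact le_of_mul_le_mul_right h3 h0

/-- The reciprocally convex combination inequality. -/
theorem reciprocally_convex {R G : Matrix (Fin n) (Fin n) ℝ}
    (hG : (Matrix.fromBlocks R G Gᵀ R).PosSemidef) (p q : Fin n → ℝ) {α β X Y : ℝ}
    (hα : 0 ≤ α) (hβ : 0 ≤ β) (hX : 0 ≤ X) (hY : 0 ≤ Y)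
    (hp : p ⬝ᵥ (R *ᵥ p) ≤ α * X) (hq : q ⬝ᵥ (R *ᵥ q) ≤ β * Y) :
    p ⬝ᵥ (R *ᵥ p) + q ⬝ᵥ (R *ᵥ q) + 2 * (p ⬝ᵥ (G *ᵥ q)) ≤ (α + β) * (X + Y) := by
  -- Testing the block matrix on `(s p, t q)` gives a nonnegative binary form, whose discriminant
  -- bounds `pᵀGq`.
  have h : ∀ s t : ℝ, 0 ≤ s ^ 2 * (p ⬝ᵥ (R *ᵥ p)) + t ^ 2 * (q ⬝ᵥ (R *ᵥ q))
      + 2 * (s * t) * (p ⬝ᵥ (G *ᵥ q)) := by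
    intro s t
    have h := PosSemidef_quad_nonneg hG (Sum.elim (s • p) (t • q))
    have h' := symBlock_quad R G R (s • p) (t • q)
    rw [symBlock] at h'
    rw [h'] at h
    simp only [mulVec_smul, dotProduct_smul, smul_dotProduct, smul_eq_mul] at h
    linarith
  have h1 := sq_le_mul_of_forall_quad_nonneg h
  have hpp : 0 ≤ p ⬝ᵥ (R *ᵥ p) := by simpa using h 1 0
  have hqq : 0 ≤ q ⬝ᵥ (R *ᵥ q) := by simpa using h 0 1
  have h2 : (p ⬝ᵥ (G *ᵥ q)) ^ 2 ≤ (α * X) * (β * Y) :=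
    h1.trans (mul_le_mul hp hq hqq (by positivity))
  -- The arithmetic-geometric mean inequality for `βX` and `αY`. No division by `α` or `β` occurs,
  -- so either part of the window may be empty.
  have h3 : 2 * (p ⬝ᵥ (G *ᵥ q)) ≤ β * X + α * Y := by
    refine le_of_abs_le (abs_le_of_sq_le_sq ?_ (by positivity))
    nlinarith [sq_nonneg (β * X - α * Y)]
  nlinarith

end EventTrigger

/-! ### Paths with locally square-integrable derivative, and integral bounds on windows. -/

namespace EventTrigger

variable {n : ℕ}

theorem intervalIntegrable_fun_sum {ι : Type*} (s : Finset ι) {f : ι → ℝ → ℝ} {a b : ℝ}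
    (h : ∀ i, IntervalIntegrable (f i) volume a b) :
    IntervalIntegrable (fun t => ∑ i ∈ s, f i t) volume a b := by
  have e : (fun t => ∑ i ∈ s, f i t) = ∑ i ∈ s, f i := by
    funext t
    rw [Finset.sum_apply]
  rw [e]
  exact IntervalIntegrable.sum s fun i _ => h i

/-- `X` is a locally absolutely continuous path in `ℝⁿ` whose derivative `F` is locally square
integrable. -/
structure IsPath (X F : ℝ → Fin n → ℝ) : Prop where
  primitive : ∀ i, IsPrimitive (fun t => X t i) (fun t => F t i)
  integrable_mul : ∀ i j a b, IntervalIntegrable (fun t => F t i * F t j) volume a b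

namespace IsPath

variable {X F : ℝ → Fin n → ℝ}

theorem quad_primitive (h : IsPath X F) (M : Matrix (Fin n) (Fin n) ℝ) :
    IsPrimitive (fun t => X t ⬝ᵥ (M *ᵥ X t))
      (fun t => F t ⬝ᵥ (M *ᵥ X t) + X t ⬝ᵥ (M *ᵥ F t)) := by
  have := IsPrimitive.sum Finset.univ fun i => (h.primitive i).mul
    (IsPrimitive.sum Finset.univ fun j => (h.primitive j).const_mul (M i j))
  refine this.congr_deriv fun t => ?_
  simp only [dotProduct, mulVec, Finset.sum_add_distrib]

theorem continuous (h : IsPath X F) : Continuous X :=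
  continuous_pi fun i => (h.primitive i).continuous

theorem quad_intervalIntegrable (h : IsPath X F) (M : Matrix (Fin n) (Fin n) ℝ) (a b : ℝ) :
    IntervalIntegrable (fun t => F t ⬝ᵥ (M *ᵥ F t)) volume a b := by
  have : (fun t => F t ⬝ᵥ (M *ᵥ F t)) = fun t => ∑ i, ∑ j, M i j * (F t i * F t j) := by
    funext t
    simp only [dotProduct, mulVec, Finset.mul_sum]
    exact Finset.sum_congr rfl fun i _ => Finset.sum_congr rfl fun j _ => by ring
  rw [this]
  refine intervalIntegrable_fun_sum _ fun i => intervalIntegrable_fun_sum _ fun j => ?_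
  exact (h.integrable_mul i j a b).const_mul _

theorem dotProduct_intervalIntegrable (h : IsPath X F) (c : Fin n → ℝ) (a b : ℝ) :
    IntervalIntegrable (fun t => c ⬝ᵥ F t) volume a b := by
  simp only [dotProduct]
  exact intervalIntegrable_fun_sum _ fun i => ((h.primitive i).intervalIntegrable a b).const_mul _

theorem integral_dotProduct (h : IsPath X F) (c : Fin n → ℝ) (a b : ℝ) :
    ∫ t in a..b, c ⬝ᵥ F t = c ⬝ᵥ (X b - X a) := by
  simp only [dotProduct]
  rw [intervalIntegral.integral_finsetSum fun i _ =>
    ((h.primitive i).intervalIntegrable a b).const_mul _]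
  refine Finset.sum_congr rfl fun i _ => ?_
  rw [intervalIntegral.integral_const_mul, (h.primitive i).integral_eq]
  rfl

/-- Jensen's inequality. -/
theorem jensen (h : IsPath X F) {R : Matrix (Fin n) (Fin n) ℝ} (hR : R.PosSemidef) {a b : ℝ}
    (hab : a ≤ b) :
    (X b - X a) ⬝ᵥ (R *ᵥ (X b - X a)) ≤ (b - a) * ∫ t in a..b, F t ⬝ᵥ (R *ᵥ F t) := by
  rcases hab.eq_or_lt with rfl | hlt
  · simp
  set D := X b - X a with hD
  set κ := (b - a)⁻¹
  have hs := PosSemidef_isSymm hR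
  -- `κ • D` is the mean of the derivative over `[a, b]`; the inequality is the nonnegativity of the
  -- variance.
  have e : ∀ t, (F t - κ • D) ⬝ᵥ (R *ᵥ (F t - κ • D)) =
      F t ⬝ᵥ (R *ᵥ F t) - 2 * κ * ((R *ᵥ D) ⬝ᵥ F t) + κ ^ 2 * (D ⬝ᵥ (R *ᵥ D)) := by
    intro t
    simp only [mulVec_sub, mulVec_smul, dotProduct_sub, sub_dotProduct, dotProduct_smul,
      smul_dotProduct, smul_eq_mul]
    rw [dotProduct_mulVec_comm_of_isSymm hs D (F t), dotProduct_comm (R *ᵥ D) (F t)]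
    ring
  have h0 : 0 ≤ ∫ t in a..b, (F t - κ • D) ⬝ᵥ (R *ᵥ (F t - κ • D)) :=
    intervalIntegral.integral_nonneg hab fun t _ => PosSemidef_quad_nonneg hR _
  simp only [e] at h0
  rw [intervalIntegral.integral_add ((h.quad_intervalIntegrable R a b).sub
    ((h.dotProduct_intervalIntegrable _ a b).const_mul _)) intervalIntegrable_const,
    intervalIntegral.integral_sub (h.quad_intervalIntegrable R a b)
    ((h.dotProduct_intervalIntegrable _ a b).const_mul _), intervalIntegral.integral_const_mul,
    h.integral_dotProduct, intervalIntegral.integral_const, ← hD, dotProduct_comm (R *ᵥ D) D,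
    smul_eq_mul] at h0
  have hκ : κ * (b - a) = 1 := inv_mul_cancel₀ (by linarith)
  have hba : 0 < b - a := by linarith
  have h1 : D ⬝ᵥ (R *ᵥ D) * κ ≤ ∫ t in a..b, F t ⬝ᵥ (R *ᵥ F t) := by
    have : (b - a) * (κ ^ 2 * (D ⬝ᵥ (R *ᵥ D))) = κ * (D ⬝ᵥ (R *ᵥ D)) := by
      rw [← mul_assoc, sq, ← mul_assoc, mul_comm (b - a), hκ, one_mul]
    linarith
  calc D ⬝ᵥ (R *ᵥ D) = (b - a) * (D ⬝ᵥ (R *ᵥ D) * κ) := by linear_combination (-(D ⬝ᵥ (R *ᵥ D))) * hκ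
    _ ≤ _ := mul_le_mul_of_nonneg_left h1 hba.le

/-- The density `e^{2 δ t} Ẋᵀ R Ẋ`. -/
noncomputable def energy (δ : ℝ) (R : Matrix (Fin n) (Fin n) ℝ) (F : ℝ → Fin n → ℝ) (t : ℝ) : ℝ :=
  Real.exp (2 * δ * t) * (F t ⬝ᵥ (R *ᵥ F t))

theorem energy_intervalIntegrable (h : IsPath X F) (δ : ℝ) (R : Matrix (Fin n) (Fin n) ℝ)
    (a b : ℝ) : IntervalIntegrable (energy δ R F) volume a b :=
  (h.quad_intervalIntegrable R a b).continuousOn_mul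
    (by fun_prop : Continuous fun t => Real.exp (2 * δ * t)).continuousOn

theorem energy_primitive (h : IsPath X F) (δ : ℝ) (R : Matrix (Fin n) (Fin n) ℝ) :
    IsPrimitive (fun t => ∫ r in (0 : ℝ)..t, energy δ R F r) (energy δ R F) :=
  IsPrimitive.of_integral (h.energy_intervalIntegrable δ R) (by simp)

theorem exp_mul_integral_le (h : IsPath X F) {δ : ℝ} (hδ : 0 ≤ δ)
    {R : Matrix (Fin n) (Fin n) ℝ} (hR : R.PosSemidef) {s a b : ℝ} (hsa : s ≤ a) (hab : a ≤ b) :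
    Real.exp (2 * δ * s) * ∫ t in a..b, F t ⬝ᵥ (R *ᵥ F t) ≤ ∫ t in a..b, energy δ R F t := by
  rw [← intervalIntegral.integral_const_mul]
  refine intervalIntegral.integral_mono_on hab ((h.quad_intervalIntegrable R a b).const_mul _)
    (h.energy_intervalIntegrable δ R a b) fun t ht => ?_
  refine mul_le_mul_of_nonneg_right (Real.exp_le_exp.2 ?_) (PosSemidef_quad_nonneg hR _)
  nlinarith [ht.1]

theorem energy_window_jensen (h : IsPath X F) {δ : ℝ} (hδ : 0 ≤ δ)
    {R : Matrix (Fin n) (Fin n) ℝ} (hR : R.PosSemidef) {a b : ℝ} (hab : a ≤ b) :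
    Real.exp (2 * δ * a) * ((X b - X a) ⬝ᵥ (R *ᵥ (X b - X a))) ≤
      (b - a) * ∫ t in a..b, energy δ R F t := by
  have h1 := h.jensen hR hab
  have h2 := h.exp_mul_integral_le hδ hR le_rfl hab
  calc _ ≤ Real.exp (2 * δ * a) * ((b - a) * ∫ t in a..b, F t ⬝ᵥ (R *ᵥ F t)) := by gcongr
    _ = (b - a) * (Real.exp (2 * δ * a) * ∫ t in a..b, F t ⬝ᵥ (R *ᵥ F t)) := by ring
    _ ≤ _ := mul_le_mul_of_nonneg_left h2 (by linarith)

/-- The intermediate time `c` splits the window into lengths `b - c` and `c - a`, whose sum is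
independent of `c`; the bound therefore holds wherever the delayed instant falls. -/
theorem energy_window_split (h : IsPath X F) {δ : ℝ} (hδ : 0 ≤ δ)
    {R G : Matrix (Fin n) (Fin n) ℝ} (hR : R.PosSemidef)
    (hG : (Matrix.fromBlocks R G Gᵀ R).PosSemidef) {a c b : ℝ} (hac : a ≤ c) (hcb : c ≤ b) :
    Real.exp (2 * δ * a) * ((X b - X c) ⬝ᵥ (R *ᵥ (X b - X c))
        + (X c - X a) ⬝ᵥ (R *ᵥ (X c - X a)) + 2 * ((X b - X c) ⬝ᵥ (G *ᵥ (X c - X a)))) ≤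
      (b - a) * ∫ t in a..b, energy δ R F t := by
  have hQ : ∀ {s t : ℝ}, s ≤ t → 0 ≤ ∫ r in s..t, F r ⬝ᵥ (R *ᵥ F r) := fun hst =>
    intervalIntegral.integral_nonneg hst fun t _ => PosSemidef_quad_nonneg hR _
  have h1 := reciprocally_convex hG (X b - X c) (X c - X a) (sub_nonneg.2 hcb) (sub_nonneg.2 hac)
    (hQ hcb) (hQ hac) (h.jensen hR hcb) (h.jensen hR hac)
  rw [add_comm (∫ r in c..b, F r ⬝ᵥ (R *ᵥ F r)), intervalIntegral.integral_add_adjacent_intervals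
    (h.quad_intervalIntegrable R a c) (h.quad_intervalIntegrable R c b),
    show b - c + (c - a) = b - a by ring] at h1
  have h2 := h.exp_mul_integral_le hδ hR le_rfl (hac.trans hcb)
  calc _ ≤ Real.exp (2 * δ * a) * ((b - a) * ∫ t in a..b, F t ⬝ᵥ (R *ᵥ F t)) := by gcongr
    _ = (b - a) * (Real.exp (2 * δ * a) * ∫ t in a..b, F t ⬝ᵥ (R *ᵥ F t)) := by ring
    _ ≤ _ := mul_le_mul_of_nonneg_left h2 (by linarith)

end IsPath

end EventTrigger

/-! ### The Lyapunov-Krasovskii functional and the bound on its derivative. -/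

namespace EventTrigger

variable {n m nz l nw nv : ℕ}

/-- The Lyapunov-Krasovskii functional along the path `X`, multiplied by `e^{2 δ t}`. -/
noncomputable def lyapunov (h ηM δ : ℝ) (P S₀ S₁ R₀ R₁ : Matrix (Fin n) (Fin n) ℝ)
    (X F : ℝ → Fin n → ℝ) (t : ℝ) : ℝ :=
  Real.exp (2 * δ * t) * (X t ⬝ᵥ (P *ᵥ X t))
    + (∫ r in (t - ηM)..(t - 0), Real.exp (2 * δ * r) * (X r ⬝ᵥ (S₀ *ᵥ X r)))
    + (∫ r in (t - (h + ηM))..(t - ηM), Real.exp (2 * δ * r) * (X r ⬝ᵥ (S₁ *ᵥ X r)))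
    + ηM * (∫ r in (t - ηM)..(t - 0), ((∫ s in (0 : ℝ)..t, IsPath.energy δ R₀ F s)
        - ∫ s in (0 : ℝ)..r, IsPath.energy δ R₀ F s))
    + h * (∫ r in (t - (h + ηM))..(t - ηM), ((∫ s in (0 : ℝ)..t, IsPath.energy δ R₁ F s)
        - ∫ s in (0 : ℝ)..r, IsPath.energy δ R₁ F s))

/-- The derivative of `lyapunov`. -/
noncomputable def lyapunovDeriv (h ηM δ : ℝ) (P S₀ S₁ R₀ R₁ : Matrix (Fin n) (Fin n) ℝ)
    (X F : ℝ → Fin n → ℝ) (t : ℝ) : ℝ :=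
  Real.exp (2 * δ * t) * (2 * δ) * (X t ⬝ᵥ (P *ᵥ X t))
    + Real.exp (2 * δ * t) * (F t ⬝ᵥ (P *ᵥ X t) + X t ⬝ᵥ (P *ᵥ F t))
    + (Real.exp (2 * δ * (t - 0)) * (X (t - 0) ⬝ᵥ (S₀ *ᵥ X (t - 0)))
        - Real.exp (2 * δ * (t - ηM)) * (X (t - ηM) ⬝ᵥ (S₀ *ᵥ X (t - ηM))))
    + (Real.exp (2 * δ * (t - ηM)) * (X (t - ηM) ⬝ᵥ (S₁ *ᵥ X (t - ηM)))
        - Real.exp (2 * δ * (t - (h + ηM)))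
          * (X (t - (h + ηM)) ⬝ᵥ (S₁ *ᵥ X (t - (h + ηM)))))
    + ηM * ((ηM - 0) * IsPath.energy δ R₀ F t
        - ∫ r in (t - ηM)..(t - 0), IsPath.energy δ R₀ F r)
    + h * ((h + ηM - ηM) * IsPath.energy δ R₁ F t
        - ∫ r in (t - (h + ηM))..(t - ηM), IsPath.energy δ R₁ F r)

theorem hasDerivAt_exp_mul (c t : ℝ) :
    HasDerivAt (fun t => Real.exp (c * t)) (Real.exp (c * t) * c) t := by
  simpa using ((hasDerivAt_id t).const_mul c).exp

theorem isPrimitive_exp_mul (c : ℝ) :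
    IsPrimitive (fun t => Real.exp (c * t)) (fun t => Real.exp (c * t) * c) :=
  IsPrimitive.of_hasDerivAt (hasDerivAt_exp_mul c) (by fun_prop)

section
variable {h ηM δ : ℝ} {P S₀ S₁ R₀ R₁ G₀ G₁ : Matrix (Fin n) (Fin n) ℝ} {X F : ℝ → Fin n → ℝ}

theorem continuous_quad (hX : IsPath X F) (M : Matrix (Fin n) (Fin n) ℝ) :
    Continuous fun t => X t ⬝ᵥ (M *ᵥ X t) := (hX.quad_primitive M).continuous

/-- The terms `t - 0` and `ηM - 0` in the two definitions are left unsimplified so that they match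
the window rules with `c = 0`. -/
theorem lyapunov_primitive (hX : IsPath X F) :
    IsPrimitive (lyapunov h ηM δ P S₀ S₁ R₀ R₁ X F)
      (lyapunovDeriv h ηM δ P S₀ S₁ R₀ R₁ X F) := by
  have hc : ∀ M : Matrix (Fin n) (Fin n) ℝ,
      Continuous fun r => Real.exp (2 * δ * r) * (X r ⬝ᵥ (M *ᵥ X r)) := fun M =>
    (by fun_prop : Continuous fun r : ℝ => Real.exp (2 * δ * r)).mul (continuous_quad hX M)
  exact (((((isPrimitive_exp_mul (2 * δ)).mul (hX.quad_primitive P)).add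
    (IsPrimitive.window (hc S₀) 0 ηM)).add (IsPrimitive.window (hc S₁) ηM (h + ηM))).add
    (((hX.energy_primitive δ R₀).doubleWindow 0 ηM).const_mul ηM)).add
    (((hX.energy_primitive δ R₁).doubleWindow ηM (h + ηM)).const_mul h)

theorem energy_nonneg {R : Matrix (Fin n) (Fin n) ℝ} (hR : R.PosSemidef) (t : ℝ) :
    0 ≤ IsPath.energy δ R F t :=
  mul_nonneg (Real.exp_pos _).le (PosSemidef_quad_nonneg hR _)

theorem energy_doubleWindow_nonneg (hX : IsPath X F) {R : Matrix (Fin n) (Fin n) ℝ}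
    (hR : R.PosSemidef) {t a b : ℝ} (hab : a ≤ b) (hbt : b ≤ t) :
    0 ≤ ∫ r in a..b, ((∫ s in (0 : ℝ)..t, IsPath.energy δ R F s)
        - ∫ s in (0 : ℝ)..r, IsPath.energy δ R F s) := by
  refine intervalIntegral.integral_nonneg hab fun r hr => ?_
  rw [intervalIntegral.integral_interval_sub_left (hX.energy_intervalIntegrable δ R _ _)
    (hX.energy_intervalIntegrable δ R _ _)]
  exact intervalIntegral.integral_nonneg (hr.2.trans hbt) fun s _ => energy_nonneg hR s

theorem quad_le_lyapunov (hX : IsPath X F) (hh : 0 ≤ h) (hηM : 0 ≤ ηM) (hS₀ : S₀.PosSemidef)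
    (hS₁ : S₁.PosSemidef) (hR₀ : R₀.PosSemidef) (hR₁ : R₁.PosSemidef) (t : ℝ) :
    Real.exp (2 * δ * t) * (X t ⬝ᵥ (P *ᵥ X t)) ≤ lyapunov h ηM δ P S₀ S₁ R₀ R₁ X F t := by
  have hw : ∀ {S : Matrix (Fin n) (Fin n) ℝ} {a b : ℝ}, S.PosSemidef → a ≤ b →
      0 ≤ ∫ r in a..b, Real.exp (2 * δ * r) * (X r ⬝ᵥ (S *ᵥ X r)) := fun hS hab =>
    intervalIntegral.integral_nonneg hab fun r _ =>
      mul_nonneg (Real.exp_pos _).le (PosSemidef_quad_nonneg hS _)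
  have h1 := hw hS₀ (show t - ηM ≤ t - 0 by linarith)
  have h2 := hw hS₁ (show t - (h + ηM) ≤ t - ηM by linarith)
  have h3 := mul_nonneg hηM (energy_doubleWindow_nonneg (δ := δ) hX hR₀
    (show t - ηM ≤ t - 0 by linarith) (show t - 0 ≤ t by linarith))
  have h4 := mul_nonneg hh (energy_doubleWindow_nonneg (δ := δ) hX hR₁
    (show t - (h + ηM) ≤ t - ηM by linarith) (show t - ηM ≤ t by linarith))
  unfold lyapunov
  linarith

/-- Here `q` lies in the older window, so the `R₁` integral is split at `q` and the `R₀` integral is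
bounded by plain Jensen. -/
theorem lyapunovDeriv_le_of_matΨ (p : Plant n m nz l nw nv) {γ : ℝ} (hX : IsPath X F)
    (hηM : 0 ≤ ηM) (hδ : 0 ≤ δ) (hP : P.IsSymm)
    (hR₀ : R₀.PosSemidef) (hR₁ : R₁.PosSemidef)
    (hG₁ : (Matrix.fromBlocks R₁ G₁ G₁ᵀ R₁).PosSemidef)
    (hΨ : (-matΨ p γ h ηM δ P S₀ S₁ R₀ R₁ G₁).PosSemidef) {t q : ℝ}
    (hq₁ : t - (h + ηM) ≤ q) (hq₂ : q ≤ t - ηM) (w : Fin nw → ℝ) (v : Fin nv → ℝ)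
    (u : Fin m → ℝ) (hu : u = p.K *ᵥ (p.C₂ *ᵥ X q + p.D₂ *ᵥ v))
    (hF : F t = p.A *ᵥ X t + p.B₁ *ᵥ w + p.B₂ *ᵥ u) :
    lyapunovDeriv h ηM δ P S₀ S₁ R₀ R₁ X F t ≤ Real.exp (2 * δ * t) *
      (γ ^ 2 * (w ⬝ᵥ w + v ⬝ᵥ v)
        - (p.C₁ *ᵥ X t + p.D₁ *ᵥ u) ⬝ᵥ (p.C₁ *ᵥ X t + p.D₁ *ᵥ u)) := by
  have hE := Real.exp_pos (2 * δ * t)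
  have key := mul_le_mul_of_nonneg_left (matΨ_dissipation p hP (PosSemidef_isSymm hR₀)
    (PosSemidef_isSymm hR₁) hΨ (X t) (X (t - ηM)) (X (t - (h + ηM))) (X q) (F t) w v u hu hF) hE.le
  have j0 := hX.energy_window_jensen hδ hR₀ (show t - ηM ≤ t by linarith)
  have j1 := hX.energy_window_split hδ hR₁ hG₁ hq₁ hq₂
  -- The factors `a` and `b` of the matrices are the weights at the left ends of the two windows,
  -- relative to the weight at `t`.
  have ea : Real.exp (2 * δ * (t - ηM)) = Real.exp (2 * δ * t) * Real.exp (-2 * δ * ηM) := by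
    rw [← Real.exp_add]; ring_nf
  have eb : Real.exp (2 * δ * (t - (h + ηM))) =
      Real.exp (2 * δ * t) * Real.exp (-2 * δ * (h + ηM)) := by
    rw [← Real.exp_add]; ring_nf
  rw [show t - (t - ηM) = ηM by ring, ea] at j0
  rw [show t - ηM - (t - (h + ηM)) = h by ring, eb] at j1
  have hH : F t ⬝ᵥ (matH h ηM R₀ R₁ *ᵥ F t) =
      ηM ^ 2 * (F t ⬝ᵥ (R₀ *ᵥ F t)) + h ^ 2 * (F t ⬝ᵥ (R₁ *ᵥ F t)) := by
    simp only [matH, add_mulVec, smul_mulVec, dotProduct_add, dotProduct_smul, smul_eq_mul]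
  rw [hH] at key
  unfold lyapunovDeriv
  rw [dotProduct_mulVec_comm_of_isSymm hP (F t) (X t), ea, eb, sub_zero, sub_zero]
  simp only [IsPath.energy] at j0 j1 ⊢
  linarith

/-- Now `q` lies in the recent window and the roles are exchanged: `R₀` is split at `q`, `R₁` is
not. -/
theorem lyapunovDeriv_le_of_matΦ (p : Plant n m nz l nw nv) {γ ε : ℝ} (hX : IsPath X F)
    (hh : 0 ≤ h) (hδ : 0 ≤ δ) (hP : P.IsSymm)
    (hR₀ : R₀.PosSemidef) (hR₁ : R₁.PosSemidef) {Ω : Matrix (Fin l) (Fin l) ℝ} (hΩ : Ω.IsSymm)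
    (hG₀ : (Matrix.fromBlocks R₀ G₀ G₀ᵀ R₀).PosSemidef)
    (hΦ : (-matΦ p γ h ηM ε δ P S₀ S₁ R₀ R₁ G₀ Ω).PosSemidef) {t q : ℝ}
    (hq₁ : t - ηM ≤ q) (hq₂ : q ≤ t) (w : Fin nw → ℝ) (v : Fin nv → ℝ) (e : Fin l → ℝ)
    (u : Fin m → ℝ) (hu : u = p.K *ᵥ (p.C₂ *ᵥ X q + p.D₂ *ᵥ v + e))
    (hF : F t = p.A *ᵥ X t + p.B₁ *ᵥ w + p.B₂ *ᵥ u) :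
    lyapunovDeriv h ηM δ P S₀ S₁ R₀ R₁ X F t ≤ Real.exp (2 * δ * t) *
      (γ ^ 2 * (w ⬝ᵥ w + v ⬝ᵥ v)
        - (p.C₁ *ᵥ X t + p.D₁ *ᵥ u) ⬝ᵥ (p.C₁ *ᵥ X t + p.D₁ *ᵥ u) + (e ⬝ᵥ (Ω *ᵥ e)
        - ε * ((p.C₂ *ᵥ X q + p.D₂ *ᵥ v) ⬝ᵥ (Ω *ᵥ (p.C₂ *ᵥ X q + p.D₂ *ᵥ v))))) := by
  have hE := Real.exp_pos (2 * δ * t)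
  have key := mul_le_mul_of_nonneg_left (matΦ_dissipation p hP hΩ (PosSemidef_isSymm hR₀)
    (PosSemidef_isSymm hR₁) hΦ (X t) (X (t - ηM)) (X (t - (h + ηM))) (X q) (F t) w v e u hu hF)
    hE.le
  have j0 := hX.energy_window_split hδ hR₀ hG₀ hq₁ hq₂
  have j1 := hX.energy_window_jensen hδ hR₁ (show t - (h + ηM) ≤ t - ηM by linarith)
  have ea : Real.exp (2 * δ * (t - ηM)) = Real.exp (2 * δ * t) * Real.exp (-2 * δ * ηM) := by
    rw [← Real.exp_add]; ring_nf
  have eb : Real.exp (2 * δ * (t - (h + ηM))) =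
      Real.exp (2 * δ * t) * Real.exp (-2 * δ * (h + ηM)) := by
    rw [← Real.exp_add]; ring_nf
  rw [show t - (t - ηM) = ηM by ring, ea] at j0
  rw [show t - ηM - (t - (h + ηM)) = h by ring, eb] at j1
  have hH : F t ⬝ᵥ (matH h ηM R₀ R₁ *ᵥ F t) =
      ηM ^ 2 * (F t ⬝ᵥ (R₀ *ᵥ F t)) + h ^ 2 * (F t ⬝ᵥ (R₁ *ᵥ F t)) := by
    simp only [matH, add_mulVec, smul_mulVec, dotProduct_add, dotProduct_smul, smul_eq_mul]
  rw [hH] at key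
  unfold lyapunovDeriv
  rw [dotProduct_mulVec_comm_of_isSymm hP (F t) (X t), ea, eb, sub_zero, sub_zero]
  simp only [IsPath.energy] at j0 j1 ⊢
  linarith

end

end EventTrigger

/-! ### The range of the delay, and local square integrability of piecewise signals. -/

namespace EventTrigger

section
variable {h ηM : ℝ} {s η : ℕ → ℝ}

theorem mul_le_sampling (h0 : s 0 = 0) (hs : ∀ k, s k + h ≤ s (k + 1)) (k : ℕ) :
    k * h ≤ s k := by
  induction k with
  | zero => simp [h0]
  | succ k ih =>
    have := hs k
    push_cast
    linarith

theorem exists_lt_updateTime (hh : 0 < h) (hη : AdmissibleDelays ηM s η) (h0 : s 0 = 0)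
    (hs : ∀ k, s k + h ≤ s (k + 1)) (T : ℝ) : ∃ k, T < updateTime s η k := by
  obtain ⟨k, hk⟩ := exists_nat_gt (T / h)
  refine ⟨k, ?_⟩
  rw [div_lt_iff₀ hh] at hk
  have := mul_le_sampling h0 hs k
  have := hη.nonneg k
  unfold updateTime
  linarith

theorem exists_mem_Ico_updateTime {t : ℝ} (hex : ∃ k, t < updateTime s η k)
    (ht : updateTime s η 0 ≤ t) :
    ∃ k, t ∈ Set.Ico (updateTime s η k) (updateTime s η (k + 1)) := by
  classical
  obtain ⟨k, hk⟩ : ∃ k, Nat.find hex = k + 1 := by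
    refine Nat.exists_eq_succ_of_ne_zero fun h0 => ?_
    have := Nat.find_spec hex
    rw [h0] at this
    linarith
  refine ⟨k, not_lt.1 (Nat.find_min hex (by omega)), ?_⟩
  rw [← hk]
  exact Nat.find_spec hex

theorem sub_delayOn_of_sampling {k : ℕ} {t : ℝ}
    (hc : t < updateTime s η k + h ∨ s (k + 1) ≤ s k + h) :
    t - delayOn h s η k t = s k := by
  rw [delayOn, if_pos hc]
  ring

/-- In the event-trigger mode `t - τ(t)` is an increasing affine function. -/
theorem sub_delayOn_of_trigger {k : ℕ} {t : ℝ} (hD : updateTime s η k + h < updateTime s η (k + 1))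
    (h1 : updateTime s η k + h ≤ t) (h2 : s k + h < s (k + 1)) :
    t - delayOn h s η k t = s k + h + (s (k + 1) - s k - h)
      / (updateTime s η (k + 1) - updateTime s η k - h) * (t - updateTime s η k - h) := by
  rw [delayOn, if_neg (by push Not; exact ⟨h1, h2⟩)]
  have hD' : updateTime s η (k + 1) - updateTime s η k - h ≠ 0 := by linarith
  field_simp
  simp only [updateTime]
  ring

/-- Along the `k`-th holding interval, `t - τ(t)` is either the sampling instant `s_k`, or a time
between `s_k + h` and `s_{k+1}` that is delayed by at most `ηM`. -/
theorem delayOn_modes (hη : AdmissibleDelays ηM s η) {k : ℕ} {t : ℝ}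
    (ht : t ∈ Set.Ico (updateTime s η k) (updateTime s η (k + 1))) :
    (t - delayOn h s η k t = s k ∧ t - (h + ηM) ≤ s k ∧ s k ≤ t) ∨
      (t - ηM ≤ t - delayOn h s η k t ∧ t - delayOn h s η k t ≤ t ∧
        s k + h ≤ t - delayOn h s η k t ∧ t - delayOn h s η k t < s (k + 1)) := by
  have e1 := hη.nonneg k
  have e2 := hη.le_max k
  have e3 := hη.nonneg (k + 1)
  have e4 := hη.le_max (k + 1)
  obtain ⟨ht1, ht2⟩ := ht
  by_cases hc : t < updateTime s η k + h ∨ s (k + 1) ≤ s k + h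
  · left
    refine ⟨sub_delayOn_of_sampling hc, ?_⟩
    unfold updateTime at ht1 ht2 hc
    -- Either `t < s_k + η_k + h`, or `t < s_{k+1} + η_{k+1}` with `s_{k+1} ≤ s_k + h`; both are at
    -- most `s_k + h + ηM`.
    rcases hc with hc | hc <;> constructor <;> linarith
  · right
    push Not at hc
    have hD : updateTime s η k + h < updateTime s η (k + 1) := hc.1.trans_lt ht2
    have hD' : 0 < updateTime s η (k + 1) - updateTime s η k - h := by linarith
    have hq := sub_delayOn_of_trigger hD hc.1 hc.2
    set D := updateTime s η (k + 1) - updateTime s η k - h with hDdef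
    have hs' : 0 < s (k + 1) - s k - h := by linarith
    have hl : t - updateTime s η k - h < D := by linarith
    have hb : (s (k + 1) - s k - h) / D * (t - updateTime s η k - h) < s (k + 1) - s k - h := by
      rw [div_mul_eq_mul_div, div_lt_iff₀ hD']
      exact mul_lt_mul_of_pos_left hl hs'
    have ha : 0 ≤ (s (k + 1) - s k - h) / D * (t - updateTime s η k - h) :=
      mul_nonneg (by positivity) (by linarith [hc.1])
    -- The fictitious delay is a convex combination of `η_k` and `η_{k+1}`, hence lies in `[0, ηM]`.
    have hτ : delayOn h s η k t = (updateTime s η (k + 1) - t) / D * η k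
        + (t - updateTime s η k - h) / D * η (k + 1) := by
      rw [delayOn, if_neg (by push Not; exact hc)]
    have hA : 0 ≤ (updateTime s η (k + 1) - t) / D := div_nonneg (by linarith) hD'.le
    have hB : 0 ≤ (t - updateTime s η k - h) / D := div_nonneg (by linarith [hc.1]) hD'.le
    have hAB : (updateTime s η (k + 1) - t) / D + (t - updateTime s η k - h) / D = 1 := by
      rw [← add_div, div_eq_one_iff_eq hD'.ne']
      ring
    have hτ0 : 0 ≤ delayOn h s η k t := by
      rw [hτ]; positivity
    have hτ1 : delayOn h s η k t ≤ ηM := by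
      rw [hτ]
      nlinarith [mul_le_mul_of_nonneg_left e2 hA, mul_le_mul_of_nonneg_left e4 hB]
    refine ⟨by linarith, by linarith, ?_, ?_⟩ <;> rw [hq] <;> linarith

end

/-- Local square integrability on `[0, ∞)`. -/
def LocallyL2 {d : ℕ} (g : ℝ → Fin d → ℝ) : Prop :=
  ∀ T, MemLp g 2 (volume.restrict (Set.Ico 0 T))

theorem memLp_two_Ico_union {d : ℕ} {g : ℝ → Fin d → ℝ} {a b c : ℝ} (hab : a ≤ b) (hbc : b ≤ c)
    (h1 : MemLp g 2 (volume.restrict (Set.Ico a b)))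
    (h2 : MemLp g 2 (volume.restrict (Set.Ico b c))) :
    MemLp g 2 (volume.restrict (Set.Ico a c)) := by
  have hm := aestronglyMeasurable_union_iff.2 ⟨h1.1, h2.1⟩
  rw [← Set.Ico_union_Ico_eq_Ico hab hbc, memLp_two_iff_integrable_sq_norm hm]
  exact IntegrableOn.union ((memLp_two_iff_integrable_sq_norm h1.1).1 h1)
    ((memLp_two_iff_integrable_sq_norm h2.1).1 h2)

namespace LocallyL2

variable {d d' : ℕ} {f g : ℝ → Fin d → ℝ}

theorem add (hf : LocallyL2 f) (hg : LocallyL2 g) : LocallyL2 fun t => f t + g t :=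
  fun T => (hf T).add (hg T)

theorem mulVec (M : Matrix (Fin d') (Fin d) ℝ) (hf : LocallyL2 f) :
    LocallyL2 fun t => M *ᵥ f t :=
  fun T => (LinearMap.toContinuousLinearMap M.mulVecLin).comp_memLp' (hf T)

theorem eval (hf : LocallyL2 f) (i : Fin d) (T : ℝ) :
    MemLp (fun t => f t i) 2 (volume.restrict (Set.Ico 0 T)) :=
  (ContinuousLinearMap.proj (R := ℝ) (φ := fun _ : Fin d => ℝ) i).comp_memLp' (hf T)

theorem of_continuousOn (hf : ContinuousOn f (Set.Ici 0)) : LocallyL2 f := by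
  intro T
  have hc : ContinuousOn f (Set.Icc 0 T) := hf.mono Set.Icc_subset_Ici_self
  obtain ⟨C, hC⟩ := isCompact_Icc.exists_bound_of_continuousOn hc
  refine MemLp.of_bound ((hc.mono Set.Ico_subset_Icc_self).aestronglyMeasurable measurableSet_Ico)
    C ?_
  filter_upwards [ae_restrict_mem measurableSet_Ico] with t ht
  exact hC t (Set.Ico_subset_Icc_self ht)

theorem of_pieces {t : ℕ → ℝ} (ht : Monotone t) (h0 : 0 ≤ t 0) (hT : ∀ T, ∃ k, T < t k)
    (hf0 : MemLp f 2 (volume.restrict (Set.Ico 0 (t 0))))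
    (hf : ∀ k, MemLp f 2 (volume.restrict (Set.Ico (t k) (t (k + 1))))) : LocallyL2 f := by
  have key : ∀ k, MemLp f 2 (volume.restrict (Set.Ico 0 (t k))) := by
    intro k
    induction k with
    | zero => exact hf0
    | succ k ih =>
      exact memLp_two_Ico_union (h0.trans (ht (Nat.zero_le k))) (ht (Nat.le_succ k)) ih (hf k)
  intro T
  obtain ⟨k, hk⟩ := hT T
  exact (key k).mono_measure (Measure.restrict_mono_set _ (Set.Ico_subset_Ico_right hk.le))

theorem intervalIntegrable_mul (hf : LocallyL2 f) (hg : LocallyL2 g) (i j : Fin d) {T : ℝ}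
    (hT : 0 ≤ T) : IntervalIntegrable (fun t => f t i * g t j) volume 0 T := by
  rw [intervalIntegrable_iff_integrableOn_Ico_of_le hT]
  exact MemLp.integrable_mul (hf.eval i T) (hg.eval j T)

theorem intervalIntegrable_dotProduct (hf : LocallyL2 f) (hg : LocallyL2 g) {T : ℝ} (hT : 0 ≤ T) :
    IntervalIntegrable (fun t => f t ⬝ᵥ g t) volume 0 T := by
  simp only [dotProduct]
  exact intervalIntegrable_fun_sum _ fun i => hf.intervalIntegrable_mul hg i i hT

end LocallyL2

theorem SquareIntegrable.memLp {d : ℕ} {v : ℝ → Fin d → ℝ} (hv : SquareIntegrable v) :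
    MemLp v 2 (volume.restrict (Set.Ici (0 : ℝ))) :=
  (EuclideanSpace.equiv (Fin d) ℝ).toContinuousLinearMap.comp_memLp' hv

theorem SquareIntegrable.locallyL2 {d : ℕ} {v : ℝ → Fin d → ℝ} (hv : SquareIntegrable v) :
    LocallyL2 v := fun _ =>
  hv.memLp.mono_measure (Measure.restrict_mono_set _ Set.Ico_subset_Ici_self)

theorem SquareIntegrable.integrableOn_dotProduct {d : ℕ} {v : ℝ → Fin d → ℝ}
    (hv : SquareIntegrable v) : IntegrableOn (fun t => v t ⬝ᵥ v t) (Set.Ici 0) := by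
  have h := hv.memLp
  have hi : ∀ i, MemLp (fun t => v t i) 2 (volume.restrict (Set.Ici (0 : ℝ))) := fun i =>
    (ContinuousLinearMap.proj (R := ℝ) (φ := fun _ : Fin d => ℝ) i).comp_memLp' h
  simp only [dotProduct]
  exact integrable_finsetSum _ fun i _ => MemLp.integrable_mul (hi i) (hi i)

/-- A nonconstant affine map sends Lebesgue measure to a constant multiple of itself. This is the
time change `t ↦ t - τ(t)` in event-trigger mode. -/
theorem memLp_comp_affine {d : ℕ} {v : ℝ → Fin d → ℝ}
    (hv : MemLp v 2 (volume.restrict (Set.Ici (0 : ℝ)))) {α : ℝ} (hα : α ≠ 0) (β : ℝ) {S : Set ℝ}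
    (hS : MeasurableSet S) (hpos : ∀ t ∈ S, 0 ≤ α * t + β) :
    MemLp (fun t => v (α * t + β)) 2 (volume.restrict S) := by
  have h1 : MemLp ((Set.Ici (0 : ℝ)).indicator v) 2 volume :=
    (memLp_indicator_iff_restrict measurableSet_Ici).2 hv
  have hmap : Measure.map (fun t : ℝ => α * t + β) volume =
      ENNReal.ofReal |α⁻¹| • (volume : Measure ℝ) := by
    have : (fun t : ℝ => α * t + β) = (fun t => t + β) ∘ fun t => α * t := rfl
    rw [this, ← Measure.map_map (by fun_prop) (by fun_prop), Real.map_volume_mul_left hα,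
      Measure.map_smul, map_add_right_eq_self]
  have h2 : MemLp (((Set.Ici (0 : ℝ)).indicator v) ∘ fun t => α * t + β) 2 volume := by
    refine MemLp.comp_of_map ?_ (by fun_prop)
    rw [hmap]
    exact h1.smul_measure ENNReal.ofReal_ne_top
  refine (h2.restrict S).ae_eq ?_
  filter_upwards [ae_restrict_mem hS] with t ht
  simp [hpos t ht]

theorem memLp_Ico_of_eq_const {d : ℕ} {g : ℝ → Fin d → ℝ} {a b : ℝ} {c : Fin d → ℝ}
    (h : ∀ t ∈ Set.Ico a b, g t = c) : MemLp g 2 (volume.restrict (Set.Ico a b)) := by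
  refine (memLp_const c).ae_eq ?_
  filter_upwards [ae_restrict_mem measurableSet_Ico] with t ht using (h t ht).symm

end EventTrigger

/-! ### Closed-loop trajectories as paths on the whole line. -/

namespace EventTrigger

variable {n m nz l nw nv : ℕ} {p : Plant n m nz l nw nv} {γ h ε ηM δ : ℝ}
  {Ω : Matrix (Fin l) (Fin l) ℝ} {w : ℝ → Fin nw → ℝ} {v : ℝ → Fin nv → ℝ} {s η : ℕ → ℝ}
  {x : ℝ → Fin n → ℝ} {u : ℝ → Fin m → ℝ}

/-- `vd` is the signal `v(t - τ(t))`, read as zero before the first update. -/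
structure IsDelayedSignal (h : ℝ) (s η : ℕ → ℝ) (v vd : ℝ → Fin nv → ℝ) : Prop where
  before : ∀ t < updateTime s η 0, vd t = 0
  held : ∀ k, ∀ t ∈ Set.Ico (updateTime s η k) (updateTime s η (k + 1)),
    vd t = v (t - delayOn h s η k t)

/-- The state, continued by its initial value to negative times. -/
def extendedState (x : ℝ → Fin n → ℝ) (t : ℝ) : Fin n → ℝ := x (max t 0)

/-- The right-hand side of the state equation, continued by zero to negative times. -/
noncomputable def extendedRhs (p : Plant n m nz l nw nv) (w : ℝ → Fin nw → ℝ)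
    (x : ℝ → Fin n → ℝ) (u : ℝ → Fin m → ℝ) : ℝ → Fin n → ℝ :=
  (Set.Ici 0).indicator (p.rhs w x u)

theorem intervalIntegrable_indicator_Ici {E : Type*} [NormedAddCommGroup E] {f : ℝ → E}
    (hf : ∀ T, 0 ≤ T → IntervalIntegrable f volume 0 T) (a b : ℝ) :
    IntervalIntegrable ((Set.Ici 0).indicator f) volume a b := by
  have h1 := (intervalIntegrable_iff_integrableOn_Ico_of_le (by positivity)).1
    (hf (|a| + |b| + 1) (by positivity))
  rw [intervalIntegrable_iff, IntegrableOn, integrable_indicator_iff measurableSet_Ici,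
    IntegrableOn, Measure.restrict_restrict measurableSet_Ici]
  refine h1.mono_set fun t ht => ⟨ht.1, ?_⟩
  have h2 := ht.2.2
  rw [le_sup_iff] at h2
  have := le_abs_self a
  have := le_abs_self b
  have := abs_nonneg a
  have := abs_nonneg b
  rcases h2 with h | h <;> linarith

theorem extendedState_of_nonneg {t : ℝ} (ht : 0 ≤ t) : extendedState x t = x t := by
  rw [extendedState, max_eq_left ht]

theorem extendedState_of_nonpos {t : ℝ} (ht : t ≤ 0) : extendedState x t = x 0 := by
  rw [extendedState, max_eq_right ht]

theorem AdmissibleDelays.monotone (hη : AdmissibleDelays ηM s η) : Monotone (updateTime s η) :=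
  monotone_nat_of_le_succ hη.updateTime_le

theorem delayedNoise_isDelayedSignal {τ : ℝ → ℝ} (hη : AdmissibleDelays ηM s η)
    (hτ : IsDelay h s η τ) : IsDelayedSignal h s η v (delayedNoise s η τ v) := by
  constructor
  · intro t ht
    exact Set.indicator_of_notMem (by simpa using ht) _
  · intro k t ht
    have : t ∈ Set.Ici (updateTime s η 0) := (hη.monotone (Nat.zero_le k)).trans ht.1
    rw [delayedNoise, Set.indicator_of_mem this, hτ k t ht]

namespace IsTrajectory

theorem sampling_step (hT : IsTrajectory p h ε ηM Ω w v s η x u) (k : ℕ) : s k + h ≤ s (k + 1) :=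
  (hT.sampling.next k).1.1

theorem sampling_nonneg (hh : 0 < h) (hT : IsTrajectory p h ε ηM Ω w v s η x u) (k : ℕ) :
    0 ≤ s k :=
  le_trans (by positivity) (mul_le_sampling hT.sampling.zero hT.sampling_step k)

theorem updateTime_zero_nonneg (hT : IsTrajectory p h ε ηM Ω w v s η x u) :
    0 ≤ updateTime s η 0 := by
  rw [updateTime, hT.sampling.zero, zero_add]
  exact hT.delays.nonneg 0

theorem exists_lt_updateTime (hh : 0 < h) (hT : IsTrajectory p h ε ηM Ω w v s η x u) (T : ℝ) :
    ∃ k, T < updateTime s η k :=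
  EventTrigger.exists_lt_updateTime hh hT.delays hT.sampling.zero hT.sampling_step T

theorem locallyL2_input (hh : 0 < h) (hT : IsTrajectory p h ε ηM Ω w v s η x u) :
    LocallyL2 u :=
  LocallyL2.of_pieces hT.delays.monotone hT.updateTime_zero_nonneg (hT.exists_lt_updateTime hh)
    (memLp_Ico_of_eq_const fun t ht => hT.input_before t ht.2)
    fun k => memLp_Ico_of_eq_const (hT.input_held k)

/-- On a holding interval the signal is the constant `v(s_k)`, possibly followed by `v` along an
affine time change. The result is only local, since the `L₂` norm of `v` does not control the
samples `v(s_k)`. -/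
theorem locallyL2_delayedSignal (hh : 0 < h) (hT : IsTrajectory p h ε ηM Ω w v s η x u)
    {vd : ℝ → Fin nv → ℝ} (hv : SquareIntegrable v) (hvd : IsDelayedSignal h s η v vd) :
    LocallyL2 vd := by
  refine LocallyL2.of_pieces hT.delays.monotone hT.updateTime_zero_nonneg
    (hT.exists_lt_updateTime hh) (memLp_Ico_of_eq_const fun t ht => hvd.before t ht.2) fun k => ?_
  have hle := hT.delays.updateTime_le k
  by_cases hc : updateTime s η (k + 1) ≤ updateTime s η k + h ∨ s (k + 1) ≤ s k + h
  · refine memLp_Ico_of_eq_const (c := v (s k)) fun t ht => ?_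
    rw [hvd.held k t ht, sub_delayOn_of_sampling (hc.imp_left fun hc => ht.2.trans_le hc)]
  · push Not at hc
    refine memLp_two_Ico_union (b := updateTime s η k + h) (by linarith) hc.1.le
      (memLp_Ico_of_eq_const (c := v (s k)) fun t ht => ?_) ?_
    · rw [hvd.held k t ⟨ht.1, ht.2.trans hc.1⟩, sub_delayOn_of_sampling (Or.inl ht.2)]
    · set α := (s (k + 1) - s k - h) / (updateTime s η (k + 1) - updateTime s η k - h) with hα
      have hα0 : 0 < α := div_pos (by linarith [hc.2]) (by linarith [hc.1])
      have e : ∀ t ∈ Set.Ico (updateTime s η k + h) (updateTime s η (k + 1)),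
          t - delayOn h s η k t = α * t + (s k + h - α * (updateTime s η k + h)) := by
        intro t ht
        rw [sub_delayOn_of_trigger hc.1 ht.1 hc.2]
        ring
      have hs := hT.sampling_nonneg hh k
      refine (memLp_comp_affine hv.memLp hα0.ne' (s k + h - α * (updateTime s η k + h))
        measurableSet_Ico fun t ht => ?_).ae_eq ?_
      · nlinarith [mul_nonneg hα0.le (sub_nonneg.2 ht.1)]
      · filter_upwards [ae_restrict_mem measurableSet_Ico] with t ht
        rw [hvd.held k t ⟨by linarith [ht.1], ht.2⟩, e t ht]

theorem intervalIntegrable_extendedRhs (hT : IsTrajectory p h ε ηM Ω w v s η x u) (a b : ℝ) :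
    IntervalIntegrable (extendedRhs p w x u) volume a b :=
  intervalIntegrable_indicator_Ici hT.integrable a b

theorem extendedState_eq (hT : IsTrajectory p h ε ηM Ω w v s η x u) (t : ℝ) :
    extendedState x t = extendedState x 0 + ∫ r in (0 : ℝ)..t, extendedRhs p w x u r := by
  rw [extendedState_of_nonneg (x := x) le_rfl]
  rcases le_total 0 t with ht | ht
  · rw [extendedState_of_nonneg ht, hT.state t ht]
    congr 1
    refine intervalIntegral.integral_congr fun r hr => ?_
    rw [Set.uIcc_of_le ht] at hr
    exact (Set.indicator_of_mem (s := Set.Ici 0) hr.1 (p.rhs w x u)).symm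
  · rw [extendedState_of_nonpos ht, intervalIntegral.integral_symm,
      intervalIntegral.integral_of_le ht, integral_Ioc_eq_integral_Ioo]
    rw [setIntegral_congr_fun (g := fun _ => (0 : Fin n → ℝ)) measurableSet_Ioo]
    · simp
    · intro r hr
      exact Set.indicator_of_notMem (by simpa using hr.2) _

theorem primitive_extendedState (hT : IsTrajectory p h ε ηM Ω w v s η x u) (i : Fin n) :
    IsPrimitive (fun t => extendedState x t i) (fun t => extendedRhs p w x u t i) := by
  let L := ContinuousLinearMap.proj (R := ℝ) (φ := fun _ : Fin n => ℝ) i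
  refine IsPrimitive.of_integral (fun a b => ?_) fun t => ?_
  · have h1 := hT.intervalIntegrable_extendedRhs a b
    rw [intervalIntegrable_iff] at h1 ⊢
    exact L.integrable_comp h1
  · have h1 := L.intervalIntegral_comp_comm (hT.intervalIntegrable_extendedRhs 0 t)
    have h2 := congrFun (hT.extendedState_eq t) i
    rw [Pi.add_apply] at h2
    rw [h2]
    congr 1
    exact h1.symm

theorem continuous_extendedState (hT : IsTrajectory p h ε ηM Ω w v s η x u) :
    Continuous (extendedState x) :=
  continuous_pi fun i => (hT.primitive_extendedState i).continuous

theorem continuousOn_state (hT : IsTrajectory p h ε ηM Ω w v s η x u) :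
    ContinuousOn x (Set.Ici 0) :=
  hT.continuous_extendedState.continuousOn.congr fun _ ht => (extendedState_of_nonneg ht).symm

theorem locallyL2_rhs (hh : 0 < h) (hT : IsTrajectory p h ε ηM Ω w v s η x u)
    (hw : LocallyL2 w) : LocallyL2 (p.rhs w x u) :=
  (((LocallyL2.of_continuousOn hT.continuousOn_state).mulVec p.A).add (hw.mulVec p.B₁)).add
    ((hT.locallyL2_input hh).mulVec p.B₂)

theorem locallyL2_controlled (hh : 0 < h) (hT : IsTrajectory p h ε ηM Ω w v s η x u) :
    LocallyL2 (p.controlled x u) :=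
  ((LocallyL2.of_continuousOn hT.continuousOn_state).mulVec p.C₁).add
    ((hT.locallyL2_input hh).mulVec p.D₁)

/-- Extending the trajectory to negative times lets the windows reach back before time zero without
case distinctions. -/
theorem isPath (hh : 0 < h) (hT : IsTrajectory p h ε ηM Ω w v s η x u) (hw : LocallyL2 w) :
    IsPath (extendedState x) (extendedRhs p w x u) := by
  refine ⟨hT.primitive_extendedState, fun i j a b => ?_⟩
  have e : (fun t => extendedRhs p w x u t i * extendedRhs p w x u t j) =
      (Set.Ici 0).indicator fun t => p.rhs w x u t i * p.rhs w x u t j := by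
    funext t
    by_cases ht : t ∈ Set.Ici (0 : ℝ)
    · simp only [extendedRhs, Set.indicator_of_mem ht]
    · simp only [extendedRhs, Set.indicator_of_notMem ht, Pi.zero_apply, mul_zero]
  rw [e]
  exact intervalIntegrable_indicator_Ici (fun T hT0 =>
    (hT.locallyL2_rhs hh hw).intervalIntegrable_mul (hT.locallyL2_rhs hh hw) i j hT0) a b

end IsTrajectory

end EventTrigger

/-! ### The dissipation inequality along trajectories and the initial value of the functional. -/

namespace EventTrigger

variable {n m nz l nw nv : ℕ}

/-- The linear matrix inequalities on the Lyapunov-Krasovskii weights. -/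
structure Feasible (p : Plant n m nz l nw nv) (γ h ηM ε δ : ℝ)
    (P S₀ S₁ R₀ R₁ G₀ G₁ : Matrix (Fin n) (Fin n) ℝ) (Ω : Matrix (Fin l) (Fin l) ℝ) : Prop where
  hP : P.PosDef
  hS₀ : S₀.PosSemidef
  hS₁ : S₁.PosSemidef
  hR₀ : R₀.PosSemidef
  hR₁ : R₁.PosSemidef
  hΩ : Ω.PosSemidef
  hΨ : (-matΨ p γ h ηM δ P S₀ S₁ R₀ R₁ G₁).PosSemidef
  hΦ : (-matΦ p γ h ηM ε δ P S₀ S₁ R₀ R₁ G₀ Ω).PosSemidef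
  hG₀ : (Matrix.fromBlocks R₀ G₀ G₀ᵀ R₀).PosSemidef
  hG₁ : (Matrix.fromBlocks R₁ G₁ G₁ᵀ R₁).PosSemidef

variable {p : Plant n m nz l nw nv} {γ h ε ηM δ : ℝ}
  {P S₀ S₁ R₀ R₁ G₀ G₁ : Matrix (Fin n) (Fin n) ℝ}
  {Ω : Matrix (Fin l) (Fin l) ℝ} {w : ℝ → Fin nw → ℝ} {v vd : ℝ → Fin nv → ℝ} {s η : ℕ → ℝ}
  {x : ℝ → Fin n → ℝ} {u : ℝ → Fin m → ℝ}

theorem IsTrajectory.delay_bound_nonneg (hT : IsTrajectory p h ε ηM Ω w v s η x u) : 0 ≤ ηM :=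
  (hT.delays.nonneg 0).trans (hT.delays.le_max 0)

theorem IsTrajectory.updateTime_zero_le (hT : IsTrajectory p h ε ηM Ω w v s η x u) :
    updateTime s η 0 ≤ ηM := by
  rw [updateTime, hT.sampling.zero, zero_add]
  exact hT.delays.le_max 0

/-- At a time of event-trigger mode, the held measurement satisfies the event-trigger bound. -/
theorem IsTrajectory.trigger_lt (hT : IsTrajectory p h ε ηM Ω w v s η x u) {k : ℕ} {q : ℝ}
    (h1 : s k + h ≤ q) (h2 : q < s (k + 1)) :
    (p.measurement x v (s k) - p.measurement x v q) ⬝ᵥ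
        (Ω *ᵥ (p.measurement x v (s k) - p.measurement x v q)) <
      ε * (p.measurement x v q ⬝ᵥ (Ω *ᵥ p.measurement x v q)) := by
  by_contra! hc
  refine absurd ((hT.sampling.next k).2 ⟨h1, ?_⟩) (not_le.2 h2)
  rw [← neg_sub (p.measurement x v (s k)), mulVec_neg, neg_dotProduct, dotProduct_neg, neg_neg]
  exact hc

theorem dissipation (hh : 0 < h) (hε : 0 ≤ ε) (hδ : 0 < δ)
    (hL : Feasible p γ h ηM ε δ P S₀ S₁ R₀ R₁ G₀ G₁ Ω)
    (hT : IsTrajectory p h ε ηM Ω w v s η x u) (hw : LocallyL2 w)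
    (hvd : IsDelayedSignal h s η v vd) {t : ℝ} (ht : 0 ≤ t) :
    lyapunovDeriv h ηM δ P S₀ S₁ R₀ R₁ (extendedState x) (extendedRhs p w x u) t ≤
      Real.exp (2 * δ * t) * (γ ^ 2 * (w t ⬝ᵥ w t + vd t ⬝ᵥ vd t)
        - p.controlled x u t ⬝ᵥ p.controlled x u t
        + (Set.Iio (updateTime s η 0)).indicator
            (fun _ => (p.C₂ *ᵥ x 0) ⬝ᵥ (Ω *ᵥ (p.C₂ *ᵥ x 0))) t) := by
  have hX := hT.isPath hh hw
  have hηM := hT.delay_bound_nonneg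
  have hPs := PosSemidef_isSymm hL.hP.posSemidef
  have hΩs := PosSemidef_isSymm hL.hΩ
  have hXt : extendedState x t = x t := extendedState_of_nonneg ht
  have hE := (Real.exp_pos (2 * δ * t)).le
  have hF : extendedRhs p w x u t = p.A *ᵥ extendedState x t + p.B₁ *ᵥ w t + p.B₂ *ᵥ u t := by
    rw [hXt]
    exact Set.indicator_of_mem (s := Set.Ici (0 : ℝ)) ht _
  have hz : p.controlled x u t = p.C₁ *ᵥ extendedState x t + p.D₁ *ᵥ u t := by
    rw [hXt, Plant.controlled]
  rw [hz]
  rcases lt_or_ge t (updateTime s η 0) with h0 | h0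
  · rw [Set.indicator_of_mem (show t ∈ Set.Iio _ from h0)]
    have hX0 : extendedState x 0 = x 0 := extendedState_of_nonneg le_rfl
    -- The zero input is written as `K(C₂x(0) + e)` with `e = -C₂x(0)`. The instant `q = 0` lies in
    -- the recent window because `t < t₀ ≤ ηM`; the cost is `eᵀΩe`.
    refine (lyapunovDeriv_le_of_matΦ p hX hh.le hδ.le hPs hL.hR₀ hL.hR₁ hΩs hL.hG₀ hL.hΦ
      (q := 0) (by linarith [hT.updateTime_zero_le]) ht (w t) (vd t) (-(p.C₂ *ᵥ x 0)) (u t)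
      ?_ hF).trans ?_
    · rw [hvd.before t h0, hX0, hT.input_before t h0]
      simp
    · refine mul_le_mul_of_nonneg_left ?_ hE
      rw [mulVec_neg, neg_dotProduct, dotProduct_neg, neg_neg]
      have := mul_nonneg hε (PosSemidef_quad_nonneg hL.hΩ
        (p.C₂ *ᵥ extendedState x 0 + p.D₂ *ᵥ vd t))
      linarith
  · rw [Set.indicator_of_notMem (show t ∉ Set.Iio _ by simpa using h0), add_zero]
    obtain ⟨k, hk⟩ := exists_mem_Ico_updateTime (hT.exists_lt_updateTime hh t) h0
    have hs0 := hT.sampling_nonneg hh k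
    have hu := hT.input_held k t hk
    have hv := hvd.held k t hk
    rcases delayOn_modes (h := h) hT.delays hk with ⟨hq, hq1, hq2⟩ | ⟨hq1, hq2, hq3, hq4⟩
    · rw [hq] at hv
      have hXs : extendedState x (s k) = x (s k) := extendedState_of_nonneg hs0
      rw [Plant.measurement, ← hXs, ← hv] at hu
      -- In sampling mode the window that contains `s_k` decides between `Ψ` and `Φ`; the error is
      -- zero.
      rcases le_total (s k) (t - ηM) with h1 | h1
      · exact lyapunovDeriv_le_of_matΨ p hX hηM hδ.le hPs hL.hR₀ hL.hR₁ hL.hG₁ hL.hΨ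
          hq1 h1 (w t) (vd t) (u t) hu hF
      · refine (lyapunovDeriv_le_of_matΦ p hX hh.le hδ.le hPs hL.hR₀ hL.hR₁ hΩs hL.hG₀ hL.hΦ
          h1 hq2 (w t) (vd t) 0 (u t) (by rw [add_zero]; exact hu) hF).trans ?_
        refine mul_le_mul_of_nonneg_left ?_ hE
        have := mul_nonneg hε (PosSemidef_quad_nonneg hL.hΩ
          (p.C₂ *ᵥ extendedState x (s k) + p.D₂ *ᵥ vd t))
        rw [zero_dotProduct]
        linarith
    · set q := t - delayOn h s η k t with hqdef
      have hXq : extendedState x q = x q := extendedState_of_nonneg (by linarith)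
      have hy : p.C₂ *ᵥ extendedState x q + p.D₂ *ᵥ vd t = p.measurement x v q := by
        rw [hXq, hv, Plant.measurement]
      -- In event-trigger mode the error is `y(s_k) - y(q)`, and the untriggered condition makes the
      -- `Ω` terms negative.
      refine (lyapunovDeriv_le_of_matΦ p hX hh.le hδ.le hPs hL.hR₀ hL.hR₁ hΩs hL.hG₀ hL.hΦ
        hq1 hq2 (w t) (vd t) (p.measurement x v (s k) - p.measurement x v q) (u t) ?_ hF).trans ?_
      · rw [hy, hu, add_sub_cancel]
      · refine mul_le_mul_of_nonneg_left ?_ hE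
        rw [hy]
        linarith [hT.trigger_lt hq3 hq4]

theorem energy_extendedRhs_integral_of_nonpos (R : Matrix (Fin n) (Fin n) ℝ) {r : ℝ}
    (hr : r ≤ 0) :
    ∫ t in (0 : ℝ)..r, IsPath.energy δ R (extendedRhs p w x u) t = 0 := by
  rw [intervalIntegral.integral_symm, intervalIntegral.integral_of_le hr,
    integral_Ioc_eq_integral_Ioo,
    setIntegral_congr_fun (g := fun _ => (0 : ℝ)) measurableSet_Ioo fun t ht => ?_]
  · simp
  · have : extendedRhs p w x u t = 0 := Set.indicator_of_notMem (by simpa using ht.2) _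
    simp [IsPath.energy, this]

theorem history_window_le {S : Matrix (Fin n) (Fin n) ℝ} (hS : S.PosSemidef) (hδ : 0 < δ)
    {a b : ℝ} (hab : a ≤ b) (hb : b ≤ 0) :
    ∫ r in a..b, Real.exp (2 * δ * r) * (extendedState x r ⬝ᵥ (S *ᵥ extendedState x r)) ≤
      (b - a) * (x 0 ⬝ᵥ (S *ᵥ x 0)) := by
  have e : ∫ r in a..b, Real.exp (2 * δ * r) * (extendedState x r ⬝ᵥ (S *ᵥ extendedState x r)) =
      ∫ r in a..b, Real.exp (2 * δ * r) * (x 0 ⬝ᵥ (S *ᵥ x 0)) := by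
    refine intervalIntegral.integral_congr fun r hr => ?_
    rw [Set.uIcc_of_le hab] at hr
    simp only [extendedState_of_nonpos (x := x) (hr.2.trans hb)]
  have hc : (b - a) * (x 0 ⬝ᵥ (S *ᵥ x 0)) = ∫ _ in a..b, x 0 ⬝ᵥ (S *ᵥ x 0) := by simp
  rw [e, hc]
  refine intervalIntegral.integral_mono_on hab
    ((by fun_prop : Continuous fun r : ℝ => Real.exp (2 * δ * r) * (x 0 ⬝ᵥ (S *ᵥ x 0))
      ).intervalIntegrable _ _) intervalIntegrable_const fun r hr => ?_
  have h1 : Real.exp (2 * δ * r) ≤ 1 := Real.exp_le_one_iff.2 (by nlinarith [hr.2])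
  exact mul_le_of_le_one_left (PosSemidef_quad_nonneg hS _) h1

/-- On negative times the extended derivative is zero, so the double integrals vanish; the state is
constant there and the weights are at most `1`. -/
theorem lyapunov_zero_le (hh : 0 < h) (hηM : 0 ≤ ηM) (hδ : 0 < δ) (hS₀ : S₀.PosSemidef)
    (hS₁ : S₁.PosSemidef) :
    lyapunov h ηM δ P S₀ S₁ R₀ R₁ (extendedState x) (extendedRhs p w x u) 0 ≤
      x 0 ⬝ᵥ (P *ᵥ x 0) + ηM * (x 0 ⬝ᵥ (S₀ *ᵥ x 0)) + h * (x 0 ⬝ᵥ (S₁ *ᵥ x 0)) := by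
  have hw : ∀ (R : Matrix (Fin n) (Fin n) ℝ) {a b : ℝ}, a ≤ b → b ≤ 0 → ∫ r in a..b,
      ((∫ s in (0 : ℝ)..0, IsPath.energy δ R (extendedRhs p w x u) s)
        - ∫ s in (0 : ℝ)..r, IsPath.energy δ R (extendedRhs p w x u) s) = 0 := by
    intro R a b hab hb
    rw [intervalIntegral.integral_congr (g := fun _ => (0 : ℝ)) fun r hr => ?_]
    · simp
    · rw [Set.uIcc_of_le hab] at hr
      simp only [energy_extendedRhs_integral_of_nonpos R (hr.2.trans hb),
        intervalIntegral.integral_same, sub_zero]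
  have h0 := history_window_le (x := x) hS₀ hδ (show 0 - ηM ≤ 0 - 0 by linarith) (by linarith)
  have h1 := history_window_le (x := x) hS₁ hδ (show 0 - (h + ηM) ≤ 0 - ηM by linarith)
    (by linarith)
  unfold lyapunov
  rw [hw R₀ (by linarith) (by linarith), hw R₁ (by linarith) (by linarith),
    extendedState_of_nonneg le_rfl, mul_zero, Real.exp_zero]
  linarith

end EventTrigger

/-! ### Exponential stability and the `L₂`-gain. -/

namespace EventTrigger

variable {n m nz l nw nv : ℕ}

theorem norm_toLp_sq {d : ℕ} (x : Fin d → ℝ) : ‖WithLp.toLp 2 x‖ ^ 2 = x ⬝ᵥ x := by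
  rw [EuclideanSpace.real_norm_sq_eq]
  simp [dotProduct, sq]

section
variable {p : Plant n m nz l nw nv} {γ h ε ηM δ : ℝ}
  {P S₀ S₁ R₀ R₁ G₀ G₁ : Matrix (Fin n) (Fin n) ℝ}
  {Ω : Matrix (Fin l) (Fin l) ℝ} {w : ℝ → Fin nw → ℝ} {v vd : ℝ → Fin nv → ℝ} {s η : ℕ → ℝ}
  {x : ℝ → Fin n → ℝ} {u : ℝ → Fin m → ℝ}

/-- `W` can grow only before the first update, which occurs by time `ηM`, at a rate at most
`e^{2δηM}` times the initial form; afterwards it is nonincreasing. -/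
theorem lyapunov_le_of_undisturbed (hh : 0 < h) (hε : 0 ≤ ε) (hδ : 0 < δ)
    (hL : Feasible p γ h ηM ε δ P S₀ S₁ R₀ R₁ G₀ G₁ Ω)
    (hT : IsTrajectory p h ε ηM Ω 0 0 s η x u) {t : ℝ} (ht : 0 ≤ t) :
    lyapunov h ηM δ P S₀ S₁ R₀ R₁ (extendedState x) (extendedRhs p 0 x u) t ≤
      lyapunov h ηM δ P S₀ S₁ R₀ R₁ (extendedState x) (extendedRhs p 0 x u) 0
        + ηM * (Real.exp (2 * δ * ηM) * ((p.C₂ *ᵥ x 0) ⬝ᵥ (Ω *ᵥ (p.C₂ *ᵥ x 0)))) := by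
  have hw : LocallyL2 (0 : ℝ → Fin nw → ℝ) := LocallyL2.of_continuousOn continuousOn_const
  -- Stability involves no `τ`; the zero signal serves as delayed noise.
  have hvd : IsDelayedSignal h s η (0 : ℝ → Fin nv → ℝ) 0 := ⟨fun _ _ => rfl, fun _ _ _ => rfl⟩
  have hW := lyapunov_primitive (h := h) (ηM := ηM) (δ := δ) (P := P) (S₀ := S₀) (S₁ := S₁)
    (R₀ := R₀) (R₁ := R₁) (hT.isPath hh hw)
  have hηM := hT.delay_bound_nonneg
  have hd := fun r (hr : (0 : ℝ) ≤ r) => dissipation hh hε hδ hL hT hw hvd hr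
  have hq := PosSemidef_quad_nonneg hL.hΩ (p.C₂ *ᵥ x 0)
  set W := lyapunov h ηM δ P S₀ S₁ R₀ R₁ (extendedState x) (extendedRhs p 0 x u)
  set q := (p.C₂ *ᵥ x 0) ⬝ᵥ (Ω *ᵥ (p.C₂ *ᵥ x 0))
  have hz := fun r => dotProduct_self_nonneg_real (p.controlled x u r)
  simp only [Pi.zero_apply, dotProduct_zero, add_zero, mul_zero, zero_sub] at hd
  have early : ∀ b, 0 ≤ b → b ≤ ηM → W b ≤ W 0 + ηM * (Real.exp (2 * δ * ηM) * q) := by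
    intro b hb hbη
    have h1 : ∫ r in (0 : ℝ)..b, lyapunovDeriv h ηM δ P S₀ S₁ R₀ R₁ (extendedState x)
        (extendedRhs p 0 x u) r ≤ ∫ _ in (0 : ℝ)..b, Real.exp (2 * δ * ηM) * q := by
      refine intervalIntegral.integral_mono_on hb (hW.intervalIntegrable _ _)
        intervalIntegrable_const fun r hr => (hd r hr.1).trans ?_
      have h2 : (Set.Iio (updateTime s η 0)).indicator (fun _ => q) r ≤ q :=
        Set.indicator_le_self' (fun _ _ => hq) r
      have h3 : Real.exp (2 * δ * r) ≤ Real.exp (2 * δ * ηM) :=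
        Real.exp_le_exp.2 (by nlinarith [hr.2])
      exact (mul_le_mul_of_nonneg_left (by linarith [hz r]) (Real.exp_pos _).le).trans
        (mul_le_mul_of_nonneg_right h3 hq)
    rw [hW.integral_eq, intervalIntegral.integral_const, sub_zero, smul_eq_mul] at h1
    have h4 : b * (Real.exp (2 * δ * ηM) * q) ≤ ηM * (Real.exp (2 * δ * ηM) * q) := by gcongr
    linarith
  rcases le_total t ηM with h0 | h0
  · exact early t ht h0
  · have h1 : ∫ r in ηM..t, lyapunovDeriv h ηM δ P S₀ S₁ R₀ R₁ (extendedState x)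
        (extendedRhs p 0 x u) r ≤ ∫ _ in ηM..t, (0 : ℝ) := by
      refine intervalIntegral.integral_mono_on h0 (hW.intervalIntegrable _ _)
        intervalIntegrable_const fun r hr => (hd r (hηM.trans hr.1)).trans ?_
      rw [Set.indicator_of_notMem (by
        simpa using hT.updateTime_zero_le.trans hr.1), add_zero]
      exact mul_nonpos_of_nonneg_of_nonpos (Real.exp_pos _).le (by linarith [hz r])
    rw [hW.integral_eq, intervalIntegral.integral_zero] at h1
    linarith [early ηM hηM le_rfl]

theorem internallyExpStable (hh : 0 < h) (hηM : 0 ≤ ηM) (hε : 0 ≤ ε) (hδ : 0 < δ)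
    (hL : Feasible p γ h ηM ε δ P S₀ S₁ R₀ R₁ G₀ G₁ Ω) :
    InternallyExpStable p h ε ηM Ω δ := by
  obtain ⟨c, hc, hcP⟩ := PosDef_coercive hL.hP
  obtain ⟨CP, hCP, hCPx⟩ := exists_quad_le P
  obtain ⟨C0, hC0, hC0x⟩ := exists_quad_le S₀
  obtain ⟨C1, hC1, hC1x⟩ := exists_quad_le S₁
  obtain ⟨CΩ, hCΩ, hCΩx⟩ := exists_quad_le (p.C₂ᵀ * Ω * p.C₂)
  set C := CP + ηM * C0 + h * C1 + ηM * (Real.exp (2 * δ * ηM) * CΩ) with hC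
  have hC' : 0 ≤ C := by positivity
  -- `C|x(0)|²` bounds `W` and `c` is the coercivity constant of `P`; adding `1` keeps the constant
  -- positive when `C = 0`.
  refine ⟨Real.sqrt ((C + 1) / c), by positivity, fun s η x u hT t ht => ?_⟩
  have hw : LocallyL2 (0 : ℝ → Fin nw → ℝ) := LocallyL2.of_continuousOn continuousOn_const
  have h1 := lyapunov_le_of_undisturbed hh hε hδ hL hT ht
  have h2 := quad_le_lyapunov (δ := δ) (P := P) (hT.isPath hh hw) hh.le hηM hL.hS₀ hL.hS₁ hL.hR₀
    hL.hR₁ t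
  have h3 := lyapunov_zero_le (p := p) (w := 0) (x := x) (u := u) (P := P) (R₀ := R₀) (R₁ := R₁)
    hh hηM hδ hL.hS₀ hL.hS₁
  rw [extendedState_of_nonneg ht] at h2
  have h4 : (p.C₂ *ᵥ x 0) ⬝ᵥ (Ω *ᵥ (p.C₂ *ᵥ x 0)) ≤ CΩ * (x 0 ⬝ᵥ x 0) := by
    have := hCΩx (x 0)
    simp only [← mulVec_mulVec, dotProduct_transpose_mulVec] at this
    exact this
  have h5 : Real.exp (2 * δ * t) * (c * (x t ⬝ᵥ x t)) ≤ C * (x 0 ⬝ᵥ x 0) := by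
    have a1 := mul_le_mul_of_nonneg_left (hcP (x t)) (Real.exp_pos (2 * δ * t)).le
    have a2 := hCPx (x 0)
    have a3 := mul_le_mul_of_nonneg_left (hC0x (x 0)) hηM
    have a4 := mul_le_mul_of_nonneg_left (hC1x (x 0)) hh.le
    have a5 := mul_le_mul_of_nonneg_left (mul_le_mul_of_nonneg_left h4
      (Real.exp_pos (2 * δ * ηM)).le) hηM
    rw [hC]
    linarith
  have hx0 := dotProduct_self_nonneg_real (x 0)
  refine le_of_sq_le_sq ?_ (by positivity)
  rw [norm_toLp_sq, mul_pow, mul_pow, norm_toLp_sq, Real.sq_sqrt (by positivity), ← Real.exp_nat_mul]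
  have h6 : Real.exp (2 * δ * t) * Real.exp (((2 : ℕ) : ℝ) * (-δ * t)) = 1 := by
    rw [← Real.exp_add, Real.exp_eq_one_iff]
    push_cast
    ring
  set E := Real.exp (2 * δ * t) with hE
  set E' := Real.exp (((2 : ℕ) : ℝ) * (-δ * t))
  have hE' : 0 < E' := Real.exp_pos _
  have h7 : c * (x t ⬝ᵥ x t) ≤ (C + 1) * E' * (x 0 ⬝ᵥ x 0) := by
    calc c * (x t ⬝ᵥ x t) = E' * (E * (c * (x t ⬝ᵥ x t))) := by
          linear_combination (-(c * (x t ⬝ᵥ x t))) * h6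
      _ ≤ E' * (C * (x 0 ⬝ᵥ x 0)) := by gcongr
      _ ≤ E' * ((C + 1) * (x 0 ⬝ᵥ x 0)) := by gcongr; linarith
      _ = _ := by ring
  rw [div_mul_eq_mul_div, div_mul_eq_mul_div, le_div_iff₀ hc]
  linarith

theorem intervalIntegrable_gainIntegrand {τ : ℝ → ℝ} (hh : 0 < h)
    (hT : IsTrajectory p h ε ηM Ω w v s η x u) (hw : SquareIntegrable w) (hv : SquareIntegrable v)
    (hτ : IsDelay h s η τ) {T : ℝ} (hT0 : 0 ≤ T) :
    IntervalIntegrable (gainIntegrand p γ s η τ w v x u) volume 0 T := by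
  have hvd := hT.locallyL2_delayedSignal hh hv (delayedNoise_isDelayedSignal hT.delays hτ)
  have hz := hT.locallyL2_controlled hh
  exact (hz.intervalIntegrable_dotProduct hz hT0).sub
    (((hw.locallyL2.intervalIntegrable_dotProduct hw.locallyL2 hT0).add
      (hvd.intervalIntegrable_dotProduct hvd hT0)).const_mul _)

/-- `V = e^{-2δt}W` satisfies `V' ≤ -2δV - gainIntegrand`, with `V(0) ≤ 0 ≤ V(T)` and `V ≥ xᵀPx`.
The term in `P` is retained as a source of strictness. -/
theorem integral_gainIntegrand_le {τ : ℝ → ℝ} (hh : 0 < h) (hε : 0 ≤ ε) (hδ : 0 < δ)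
    (hL : Feasible p γ h ηM ε δ P S₀ S₁ R₀ R₁ G₀ G₁ Ω)
    (hT : IsTrajectory p h ε ηM Ω w v s η x u) (hw : SquareIntegrable w) (hv : SquareIntegrable v)
    (hτ : IsDelay h s η τ) (hx0 : x 0 = 0) {T : ℝ} (hT0 : 0 ≤ T) :
    ∫ t in (0 : ℝ)..T, gainIntegrand p γ s η τ w v x u t ≤
      -(2 * δ) * ∫ t in (0 : ℝ)..T, extendedState x t ⬝ᵥ (P *ᵥ extendedState x t) := by
  have hvd := delayedNoise_isDelayedSignal (v := v) hT.delays hτ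
  have hηM := hT.delay_bound_nonneg
  have hX := hT.isPath hh hw.locallyL2
  have hW := lyapunov_primitive (h := h) (ηM := ηM) (δ := δ) (P := P) (S₀ := S₀) (S₁ := S₁)
    (R₀ := R₀) (R₁ := R₁) hX
  have hW0 := lyapunov_zero_le (p := p) (w := w) (x := x) (u := u) (P := P) (R₀ := R₀) (R₁ := R₁)
    hh hηM hδ hL.hS₀ hL.hS₁
  have hWx := quad_le_lyapunov (δ := δ) (P := P) hX hh.le hηM hL.hS₀ hL.hS₁ hL.hR₀ hL.hR₁
  have hd := fun r (hr : (0 : ℝ) ≤ r) => dissipation hh hε hδ hL hT hw.locallyL2 hvd hr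
  simp only [hx0, mulVec_zero, dotProduct_zero, mul_zero, add_zero, Set.indicator_zero] at hW0 hd
  set W := lyapunov h ηM δ P S₀ S₁ R₀ R₁ (extendedState x) (extendedRhs p w x u)
  have hV := (isPrimitive_exp_mul (-(2 * δ))).mul hW
  have hEE : ∀ t, Real.exp (-(2 * δ) * t) * Real.exp (2 * δ * t) = 1 := fun t => by
    rw [← Real.exp_add, Real.exp_eq_one_iff]
    ring
  have hVx : ∀ t, extendedState x t ⬝ᵥ (P *ᵥ extendedState x t) ≤
      Real.exp (-(2 * δ) * t) * W t := by
    intro t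
    have := mul_le_mul_of_nonneg_left (hWx t) (Real.exp_pos (-(2 * δ) * t)).le
    rwa [← mul_assoc, hEE, one_mul] at this
  have hVT : 0 ≤ Real.exp (-(2 * δ) * T) * W T :=
    (PosSemidef_quad_nonneg hL.hP.posSemidef _).trans (hVx T)
  have hg := intervalIntegrable_gainIntegrand (γ := γ) hh hT hw hv hτ hT0
  have hq := (continuous_quad hX P).intervalIntegrable (μ := volume) 0 T
  have h1 := intervalIntegral.integral_mono_on hT0 (hV.intervalIntegrable 0 T)
    ((hq.const_mul (-(2 * δ))).sub hg) fun t ht => ?_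
  · rw [hV.integral_eq, intervalIntegral.integral_sub (hq.const_mul _) hg,
      intervalIntegral.integral_const_mul, mul_zero, Real.exp_zero, one_mul] at h1
    linarith
  · have h2 := mul_le_mul_of_nonneg_left (hd t ht.1) (Real.exp_pos (-(2 * δ) * t)).le
    rw [← mul_assoc, hEE, one_mul] at h2
    have h3 := mul_le_mul_of_nonneg_left (hVx t) (show 0 ≤ 2 * δ by linarith)
    simp only [gainIntegrand, disturbance]
    linarith

/-- Along the zero state the gain integrand is nonpositive, and it vanishes only together with
the disturbance. -/
theorem gainIntegrand_of_state_zero {τ : ℝ → ℝ} (hγ : 0 < γ) (hh : 0 < h) (hε : 0 ≤ ε)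
    (hL : Feasible p γ h ηM ε δ P S₀ S₁ R₀ R₁ G₀ G₁ Ω)
    (hT : IsTrajectory p h ε ηM Ω w v s η x u) (hτ : IsDelay h s η τ)
    (hx : ∀ t, 0 ≤ t → x t = 0) {t : ℝ} (ht : 0 ≤ t) :
    gainIntegrand p γ s η τ w v x u t ≤ 0 ∧
      (gainIntegrand p γ s η τ w v x u t = 0 → disturbance s η τ w v t = 0) := by
  have hvd := delayedNoise_isDelayedSignal (v := v) hT.delays hτ
  set vd := delayedNoise s η τ v
  have hPs := PosSemidef_isSymm hL.hP.posSemidef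
  have hww := dotProduct_self_nonneg_real (w t)
  have hγ2 : 0 < γ ^ 2 := by positivity
  have hz : p.controlled x u t = p.D₁ *ᵥ u t := by
    rw [Plant.controlled, hx t ht, mulVec_zero, zero_add]
  have key : (vd t = 0 ∧ p.D₁ *ᵥ u t = 0) ∨
      (p.D₁ *ᵥ u t) ⬝ᵥ (p.D₁ *ᵥ u t) < γ ^ 2 * (vd t ⬝ᵥ vd t) := by
    rcases lt_or_ge t (updateTime s η 0) with h0 | h0
    · exact Or.inl ⟨hvd.before t h0, by rw [hT.input_before t h0, mulVec_zero]⟩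
    · obtain ⟨k, hk⟩ := exists_mem_Ico_updateTime (hT.exists_lt_updateTime hh t) h0
      have hs0 := hT.sampling_nonneg hh k
      have hu := hT.input_held k t hk
      have hv := hvd.held k t hk
      rcases delayOn_modes (h := h) hT.delays hk with ⟨hq, -⟩ | ⟨-, -, hq3, hq4⟩
      · rw [hq] at hv
        rw [Plant.measurement, hx _ hs0, mulVec_zero, zero_add, ← hv] at hu
        rw [hu]
        by_cases hv0 : vd t = 0
        · left
          simp [hv0]
        · right
          exact feedthrough_lt p hγ hε hPs hL.hΩ hL.hR₀ hL.hR₁ hL.hΦ hv0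
      · right
        set q := t - delayOn h s η k t with hqdef
        have htr := hT.trigger_lt hq3 hq4
        have hy : p.measurement x v q = p.C₂ *ᵥ 0 + p.D₂ *ᵥ vd t := by
          rw [Plant.measurement, hx q (by linarith), hv]
        -- At zero states `Φ` bounds `|D₁u|² - γ²|v(q)|²` by `eᵀΩe - ε y(q)ᵀΩy(q)`, which is
        -- strictly negative before the trigger fires.
        have h1 := matΦ_dissipation p hPs (PosSemidef_isSymm hL.hΩ) (PosSemidef_isSymm hL.hR₀)
          (PosSemidef_isSymm hL.hR₁) hL.hΦ 0 0 0 0 _ 0 (vd t)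
          (p.measurement x v (s k) - p.measurement x v q) (u t)
          (by rw [← hy, add_sub_cancel, hu]) rfl
        have h2 := PosSemidef_quad_nonneg (matH_posSemidef (h := h) (ηM := ηM) hL.hR₀ hL.hR₁)
          (p.A *ᵥ 0 + p.B₁ *ᵥ 0 + p.B₂ *ᵥ u t)
        rw [← hy] at h1
        simp only [mulVec_zero, zero_add, sub_zero, dotProduct_zero, mul_zero, zero_dotProduct,
          add_zero] at h1 h2
        linarith
  simp only [gainIntegrand, disturbance, hz, show delayedNoise s η τ v = vd from rfl]
  rcases key with ⟨h1, h2⟩ | h1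
  · rw [h1, h2]
    simp only [dotProduct_zero, add_zero, zero_sub, neg_eq_zero, mul_eq_zero]
    exact ⟨by nlinarith, fun h => h.resolve_left hγ2.ne'⟩
  · have : (p.D₁ *ᵥ u t) ⬝ᵥ (p.D₁ *ᵥ u t) - γ ^ 2 * (w t ⬝ᵥ w t + vd t ⬝ᵥ vd t) < 0 := by
      nlinarith
    exact ⟨this.le, fun h => absurd h this.ne⟩

theorem exists_integral_gainIntegrand_le {τ : ℝ → ℝ} (hγ : 0 < γ) (hh : 0 < h) (hε : 0 ≤ ε)
    (hδ : 0 < δ) (hL : Feasible p γ h ηM ε δ P S₀ S₁ R₀ R₁ G₀ G₁ Ω)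
    (hT : IsTrajectory p h ε ηM Ω w v s η x u) (hw : SquareIntegrable w) (hv : SquareIntegrable v)
    (hτ : IsDelay h s η τ) (hx0 : x 0 = 0)
    (hne : ¬ (disturbance s η τ w v =ᵐ[volume.restrict (Set.Ici (0 : ℝ))] 0)) :
    ∃ c : ℝ, 0 < c ∧ ∀ᶠ T in atTop,
      ∫ t in (0 : ℝ)..T, gainIntegrand p γ s η τ w v x u t ≤ -c := by
  have hX := hT.isPath hh hw.locallyL2
  have hg := fun T (hT0 : (0 : ℝ) ≤ T) => intervalIntegrable_gainIntegrand (γ := γ) hh hT hw hv hτ hT0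
  by_cases hx : ∀ t, 0 ≤ t → x t = 0
  -- With zero state the integrals decrease in `T`. Were they never negative, the integrand and
  -- hence the disturbance would vanish almost everywhere.
  · have hp := fun t (ht : (0 : ℝ) ≤ t) => gainIntegrand_of_state_zero hγ hh hε hL hT hτ hx ht
    have hanti : ∀ a b, 0 ≤ a → a ≤ b → ∫ t in (0 : ℝ)..b, gainIntegrand p γ s η τ w v x u t ≤
        ∫ t in (0 : ℝ)..a, gainIntegrand p γ s η τ w v x u t := by
      intro a b ha hab
      have hgab := (hg a ha).symm.trans (hg b (ha.trans hab))
      rw [← intervalIntegral.integral_add_adjacent_intervals (hg a ha) hgab]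
      have : 0 ≤ ∫ t in a..b, -gainIntegrand p γ s η τ w v x u t :=
        intervalIntegral.integral_nonneg hab fun t ht =>
          neg_nonneg.2 (hp t (ha.trans ht.1)).1
      rw [intervalIntegral.integral_neg] at this
      linarith
    obtain ⟨T, hT0, hneg⟩ : ∃ T, 0 ≤ T ∧
        ∫ t in (0 : ℝ)..T, gainIntegrand p γ s η τ w v x u t < 0 := by
      by_contra! hc
      refine hne ?_
      have hN : ∀ N : ℕ, ∀ᵐ t ∂(volume.restrict (Set.Ico (0 : ℝ) N)),
          disturbance s η τ w v t = 0 := by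
        intro N
        have h1 := hc N N.cast_nonneg
        have h2 := (intervalIntegrable_iff_integrableOn_Ico_of_le N.cast_nonneg).1
          (hg N N.cast_nonneg)
        have h3 : ∫ t in Set.Ico (0 : ℝ) N, -gainIntegrand p γ s η τ w v x u t ≤ 0 := by
          rw [integral_neg, integral_Ico_eq_integral_Ioo, ← integral_Ioc_eq_integral_Ioo,
            ← intervalIntegral.integral_of_le N.cast_nonneg]
          linarith
        have h4 : 0 ≤ᵐ[volume.restrict (Set.Ico (0 : ℝ) N)]
            fun t => -gainIntegrand p γ s η τ w v x u t := by
          filter_upwards [ae_restrict_mem measurableSet_Ico] with t ht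
          exact neg_nonneg.2 (hp t ht.1).1
        have h5 := (setIntegral_eq_zero_iff_of_nonneg_ae h4 h2.neg).1
          (le_antisymm h3 (integral_nonneg_of_ae h4))
        filter_upwards [h5, ae_restrict_mem measurableSet_Ico] with t h6 ht
        exact (hp t ht.1).2 (by simpa using h6)
      have hU : Set.Ici (0 : ℝ) ⊆ ⋃ N : ℕ, Set.Ico (0 : ℝ) N := by
        intro t ht
        obtain ⟨N, hN⟩ := exists_nat_gt t
        exact Set.mem_iUnion.2 ⟨N, ht, hN⟩
      exact ae_restrict_of_ae_restrict_of_subset hU ((ae_restrict_iUnion_iff _ _).2 hN)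
    refine ⟨-∫ t in (0 : ℝ)..T, gainIntegrand p γ s η τ w v x u t, by linarith, ?_⟩
    filter_upwards [eventually_ge_atTop T] with b hb
    rw [neg_neg]
    exact hanti T b hT0 hb
  · push Not at hx
    obtain ⟨t₁, ht₁, hxt⟩ := hx
    have hcont := continuous_quad hX P
    have hnn : ∀ t, 0 ≤ extendedState x t ⬝ᵥ (P *ᵥ extendedState x t) := fun t =>
      PosSemidef_quad_nonneg hL.hP.posSemidef _
    -- The endpoint `t₁ + 1` keeps the interval nondegenerate even if `t₁ = 0`.
    have hpos : 0 < ∫ t in (0 : ℝ)..(t₁ + 1), extendedState x t ⬝ᵥ (P *ᵥ extendedState x t) := by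
      refine intervalIntegral.integral_pos (by linarith) hcont.continuousOn (fun t _ => hnn t)
        ⟨t₁, ⟨ht₁, by linarith⟩, ?_⟩
      rw [extendedState_of_nonneg ht₁]
      simpa using hL.hP.dotProduct_mulVec_pos hxt
    refine ⟨2 * δ * ∫ t in (0 : ℝ)..(t₁ + 1), extendedState x t ⬝ᵥ (P *ᵥ extendedState x t),
      by positivity, ?_⟩
    filter_upwards [eventually_ge_atTop (t₁ + 1)] with T hT1
    have h1 := integral_gainIntegrand_le hh hε hδ hL hT hw hv hτ hx0 (show 0 ≤ T by linarith)
    have h2 : ∫ t in (0 : ℝ)..(t₁ + 1), extendedState x t ⬝ᵥ (P *ᵥ extendedState x t) ≤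
        ∫ t in (0 : ℝ)..T, extendedState x t ⬝ᵥ (P *ᵥ extendedState x t) := by
      rw [← intervalIntegral.integral_add_adjacent_intervals (hcont.intervalIntegrable 0 (t₁ + 1))
        (hcont.intervalIntegrable (t₁ + 1) T)]
      have := intervalIntegral.integral_nonneg (μ := volume) hT1 fun t _ => hnn t
      linarith
    nlinarith

/-- The finite-horizon estimate bounds `∫|z|²` over `[0, T]` by `γ²` times the total disturbance
energy, uniformly in `T`. -/
theorem integrableOn_gainIntegrand {τ : ℝ → ℝ} (hh : 0 < h) (hε : 0 ≤ ε) (hδ : 0 < δ)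
    (hL : Feasible p γ h ηM ε δ P S₀ S₁ R₀ R₁ G₀ G₁ Ω)
    (hT : IsTrajectory p h ε ηM Ω w v s η x u) (hw : SquareIntegrable w) (hv : SquareIntegrable v)
    (hτ : IsDelay h s η τ) (hx0 : x 0 = 0) (hd : SquareIntegrable (delayedNoise s η τ v)) :
    IntegrableOn (gainIntegrand p γ s η τ w v x u) (Set.Ici 0) := by
  have hD : IntegrableOn (disturbance s η τ w v) (Set.Ici 0) :=
    hw.integrableOn_dotProduct.add hd.integrableOn_dotProduct
  have hD0 : ∀ t, 0 ≤ disturbance s η τ w v t := fun t =>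
    add_nonneg (dotProduct_self_nonneg_real _) (dotProduct_self_nonneg_real _)
  have hz := hT.locallyL2_controlled hh
  have hZ : IntegrableOn (fun t => p.controlled x u t ⬝ᵥ p.controlled x u t) (Set.Ici 0) := by
    rw [integrableOn_Ici_iff_integrableOn_Ioi]
    refine integrableOn_Ioi_of_intervalIntegral_norm_bounded
      (γ ^ 2 * ∫ t in Set.Ici (0 : ℝ), disturbance s η τ w v t) 0 (l := atTop) (b := id)
      (fun T => ?_) tendsto_id ?_
    · rcases le_total 0 T with hT0 | hT0
      · exact (intervalIntegrable_iff_integrableOn_Ioc_of_le hT0).1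
          (hz.intervalIntegrable_dotProduct hz hT0)
      · rw [id, Set.Ioc_eq_empty (not_lt.2 hT0)]
        exact integrableOn_empty
    · filter_upwards [eventually_ge_atTop (0 : ℝ)] with T hT0
      simp only [id]
      have hDi : IntervalIntegrable (disturbance s η τ w v) volume 0 T := by
        rw [intervalIntegrable_iff_integrableOn_Ico_of_le hT0]
        exact hD.mono_set Set.Ico_subset_Ici_self
      have h1 := integral_gainIntegrand_le hh hε hδ hL hT hw hv hτ hx0 hT0
      have h2 : 0 ≤ ∫ t in (0 : ℝ)..T, extendedState x t ⬝ᵥ (P *ᵥ extendedState x t) :=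
        intervalIntegral.integral_nonneg hT0 fun t _ =>
          PosSemidef_quad_nonneg hL.hP.posSemidef _
      have h3 : ∫ t in (0 : ℝ)..T, gainIntegrand p γ s η τ w v x u t =
          (∫ t in (0 : ℝ)..T, p.controlled x u t ⬝ᵥ p.controlled x u t)
            - γ ^ 2 * ∫ t in (0 : ℝ)..T, disturbance s η τ w v t := by
        rw [← intervalIntegral.integral_const_mul]
        exact intervalIntegral.integral_sub (hz.intervalIntegrable_dotProduct hz hT0)
          (hDi.const_mul _)
      have h4 : ∫ t in (0 : ℝ)..T, disturbance s η τ w v t ≤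
          ∫ t in Set.Ici (0 : ℝ), disturbance s η τ w v t := by
        rw [intervalIntegral.integral_of_le hT0]
        exact setIntegral_mono_set hD (Eventually.of_forall hD0)
          (Set.Ioc_subset_Icc_self.trans Set.Icc_subset_Ici_self).eventuallyLE
      simp only [Real.norm_of_nonneg (dotProduct_self_nonneg_real _)]
      have h5 := mul_le_mul_of_nonneg_left h4 (sq_nonneg γ)
      nlinarith
  exact hZ.sub (hD.const_mul _)

theorem l2GainLT (hγ : 0 < γ) (hh : 0 < h) (hε : 0 ≤ ε) (hδ : 0 < δ)
    (hL : Feasible p γ h ηM ε δ P S₀ S₁ R₀ R₁ G₀ G₁ Ω) : L2GainLT p h ε ηM Ω γ := by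
  intro w v s η τ x u hw hv hT hτ hx0 hne
  have hc := exists_integral_gainIntegrand_le hγ hh hε hδ hL hT hw hv hτ hx0 hne
  refine ⟨fun T hT0 => intervalIntegrable_gainIntegrand hh hT hw hv hτ hT0, hc, fun hd => ?_⟩
  have hI := integrableOn_gainIntegrand hh hε hδ hL hT hw hv hτ hx0 hd
  refine ⟨hI, ?_⟩
  obtain ⟨c, hc0, hc⟩ := hc
  rw [integral_Ici_eq_integral_Ioi]
  have h1 := intervalIntegral_tendsto_integral_Ioi 0
    ((integrableOn_Ici_iff_integrableOn_Ioi).1 hI) tendsto_id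
  linarith [le_of_tendsto h1 hc]

end

end EventTrigger

theorem theorem2 {n m nz l nw nv : ℕ} (p : EventTrigger.Plant n m nz l nw nv)
    (γ h ηM ε δ : ℝ) (hγ : 0 < γ) (hh : 0 < h) (hηM : 0 ≤ ηM) (hε : 0 ≤ ε) (hδ : 0 < δ)
    (P S₀ S₁ R₀ R₁ G₀ G₁ : Matrix (Fin n) (Fin n) ℝ) (Ω : Matrix (Fin l) (Fin l) ℝ)
    (hP : P.PosDef) (hS₀ : S₀.PosSemidef) (hS₁ : S₁.PosSemidef)
    (hR₀ : R₀.PosSemidef) (hR₁ : R₁.PosSemidef) (hΩ : Ω.PosSemidef)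
    (hΨ : (-EventTrigger.matΨ p γ h ηM δ P S₀ S₁ R₀ R₁ G₁).PosSemidef)
    (hΦ : (-EventTrigger.matΦ p γ h ηM ε δ P S₀ S₁ R₀ R₁ G₀ Ω).PosSemidef)
    (hG₀ : (Matrix.fromBlocks R₀ G₀ G₀ᵀ R₀).PosSemidef)
    (hG₁ : (Matrix.fromBlocks R₁ G₁ G₁ᵀ R₁).PosSemidef) :
    EventTrigger.InternallyExpStable p h ε ηM Ω δ ∧
      EventTrigger.L2GainLT p h ε ηM Ω γ := by
  have hL : EventTrigger.Feasible p γ h ηM ε δ P S₀ S₁ R₀ R₁ G₀ G₁ Ω :=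
    ⟨hP, hS₀, hS₁, hR₀, hR₁, hΩ, hΨ, hΦ, hG₀, hG₁⟩
  exact ⟨EventTrigger.internallyExpStable hh hηM hε hδ hL,
    EventTrigger.l2GainLT hγ hh hε hδ hL⟩
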